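/- Let $\mathfrak P=(P_{n,\pm})_{n\ge 0}$ be a subfactor planar algebra, that is, a shaded planar $*$-algebra over $\mathbb C$ (labelled planar tangles act multilinearly on the spaces, invariantly under planar isotopy and compatibly with gluing; the conjugate-linear involutions $*$ are compatible with reflection of tangles) such that all $P_{n,\pm}$ are finite dimensional, $\dim P_{0,\pm}=1$, $\mathfrak P$ is spherical, and on every $P_{n,\pm}$ the form which sends $(x,y)$ to the closed tangle joining all marked points of $x$ to the mirror-image points of $y^*$ is positive definite. Write $P_n=P_{n,+}$ (distinguished interval in an unshaded region) and let $\delta$ be the value of a closed loop. Fix $k\ge 0$ and put $Gr_k(\mathfrak P)=\bigoplus_{n\ge 0}P_{n,k}$ (algebraic direct sum), where $P_{n,k}=P_{n+k}$. Draw an element of $P_{n,k}$ as a rectangle with $2n$ strings at the top, $k$ strings on the left and $k$ strings on the right, with the distinguished interval at the top left corner. Equip $Gr_k(\mathfrak P)$ with the following structure. 1. The inner product $\langle\cdot,\cdot\rangle$, linear in the first variable, for which the summands $P_{n,k}$ are mutually orthogonal and $\langle a,b\rangle$, for $a,b\in P_{n,k}$, is $\delta^{-k}$ times the value of the closed tangle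 in which all marked points of $a$ are joined to the mirror-image points of the reflection of $b$. 2. The bilinear product $\star$ given for $a\in P_{m,k}$, $b\in P_{n,k}$ by $a\star b=\sum_{i=0}^{\min(2m,2n)}(a\star b)_i$. Here $(a\star b)_i\in P_{m+n-i,k}$ is obtained by placing $a$ to the left of $b$, joining the $k$ right strings of $a$ to the $k$ left strings of $b$, and joining the last $i$ top strings of $a$ to the first $i$ top strings of $b$ by parallel strings. 3. The conjugate-linear involution $^*$ which sends $a\in P_{n,k}$ to the reflection of its rectangle in a vertical line (this exchanges the left and right strings), read again as an element of $P_{n,k}$ with the distinguished interval at the top left corner. Then for every $a\in Gr_k(\mathfrak P)$ the left multiplication $L_a:\xi\mapsto a\star\xi$ is bounded: there is a constant $C$ with $\|a\star\xi\|\le C\|\xi\|$ for all $\xi\in Gr_k(\mathfrak P)$, where $\|\xi\|=\langle\xi,\xi\rangle^{1/2}$. Moreover $Gr_k(\mathfrak P)$ is a Hilbert algebra: $(Gr_k(\mathfrak P),\star,{}^*)$ is an associative $*$-algebra, $\langle\cdot,\cdot\rangle$ is a positive definite inner product, $\langle b^*,a^*\rangle=\langle a,b\rangle$ and $\langle a\star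 b,c\rangle=\langle b,a^*\star c\rangle$ for all $a,b,c$, every left multiplication is bounded, and the linear span of the products $a\star b$ is dense in $Gr_k(\mathfrak P)$. -/

import Mathlib

universe u

/-!
Shaded planar tangles, planar algebras, planar star-algebras, subfactor planar algebras,
the graded algebras `Gr k`, and Hilbert algebras.

A planar tangle is written in general position with respect to the height function: the outer disc
is a rectangle whose marked points all lie on the top edge, each input disc is a small rectangle
whose marked points all lie on its top edge, and no two singular heights (input discs, local
minima and local maxima of strings) coincide. Reading upwards, a tangle is then a finite list of
layers. The distinguished boundary interval of every disc is the one which runs from its last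
marked point (top right), along the right, bottom and left edges, to its first one (top left), so
that the marked points are numbered clockwise, from left to right along the top edge.
Every planar tangle is isotopic to one of this form, and two tangles of this form are isotopic if
and only if they are related by the moves of `Word.Move` below.
-/

/-- The colour (`true`: unshaded, `false`: shaded) of the region that is reached from a region of
colour `s` by crossing `p` strings. -/
def regionColour (s : Bool) (p : ℕ) : Bool := if Even p then s else !s

/-- The singular pieces of a (labelled) tangle: a local minimum of a string, a local maximum of a
string, and an input disc with `2 * n` marked points, distinguished interval in a region of
colour `t`, labelled by `v`. -/
inductive Piece (P : Bool → ℕ → Type u) : Type u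
  | cup : Piece P
  | cap : Piece P
  | box (t : Bool) (n : ℕ) (v : P t n) : Piece P

namespace Piece

variable {P : Bool → ℕ → Type u}

/-- Number of strings entering a piece from below. -/
def inp : Piece P → ℕ
  | cup => 0
  | cap => 2
  | box _ _ _ => 0

/-- Number of strings leaving a piece upwards. -/
def out : Piece P → ℕ
  | cup => 2
  | cap => 0
  | box _ n _ => 2 * n

/-- The piece may be put into a region of colour `c`. -/
def Allowed (c : Bool) : Piece P → Prop
  | cup => True
  | cap => True
  | box t _ _ => t = c

/-- Apply an operation to the label. -/
def map (f : ∀ {s : Bool} {n : ℕ}, P s n → P s n) : Piece P → Piece P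
  | cup => cup
  | cap => cap
  | box t n v => box t n (f v)

end Piece

/-- A horizontal layer of a tangle: one singular piece, with `pos` vertical strings to its left (and
any number of vertical strings to its right). -/
structure Layer (P : Bool → ℕ → Type u) : Type u where
  pos : ℕ
  piece : Piece P

/-- A stack of layers, listed from bottom to top. -/
abbrev Word (P : Bool → ℕ → Type u) : Type u := List (Layer P)

namespace Word

variable {P : Bool → ℕ → Type u}

/-- `Fits s w m m'`: if the leftmost region has colour `s`, the stack `w` can be put on top of `m`
vertical strings, and then has `m'` strings at its top. -/
def Fits (s : Bool) : Word P → ℕ → ℕ → Prop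
  | [], m, m' => m = m'
  | l :: w, m, m' =>
      l.pos + l.piece.inp ≤ m ∧ l.piece.Allowed (regionColour s l.pos) ∧
        Fits s w (m - l.piece.inp + l.piece.out) m'

/-- Add `a` vertical strings on the left. -/
def shift (a : ℕ) (w : Word P) : Word P := w.map fun l => ⟨a + l.pos, l.piece⟩

/-- `j` nested local minima, which create the adjacent strings number `p, …, p + 2 * j - 1`
(counted from `0`); string `p + t` is the same as string `p + 2 * j - 1 - t`. -/
def cups : ℕ → ℕ → Word P
  | _, 0 => []
  | p, j + 1 => ⟨p, Piece.cup⟩ :: cups (p + 1) j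

/-- `j` nested local maxima, which join string `p + t` to string `p + 2 * j - 1 - t`, `t < j`. -/
def caps (p : ℕ) : ℕ → Word P
  | 0 => []
  | j + 1 => ⟨p + j, Piece.cap⟩ :: caps p j

/-- Reflection in a vertical line of a stack on `m` strings; every label is replaced by its image
under `f`. -/
def reflect (f : ∀ {s : Bool} {n : ℕ}, P s n → P s n) : ℕ → Word P → Word P
  | _, [] => []
  | m, l :: w =>
      ⟨m - l.piece.inp - l.pos, l.piece.map f⟩ ::
        reflect f (m - l.piece.inp + l.piece.out) w

/-- The elementary planar isotopies. -/
inductive Move : Word P → Word P → Prop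
  /-- Two pieces side by side may exchange their heights. -/
  | exchange (p r : ℕ) (g h : Piece P) :
      Move [⟨p, g⟩, ⟨p + g.out + r, h⟩] [⟨p + g.inp + r, h⟩, ⟨p, g⟩]
  /-- A string with a minimum followed on its right by a maximum may be straightened. -/
  | straighten_right (p : ℕ) : Move [⟨p, Piece.cup⟩, ⟨p + 1, Piece.cap⟩] []
  /-- A string with a minimum followed on its left by a maximum may be straightened. -/
  | straighten_left (p : ℕ) : Move [⟨p + 1, Piece.cup⟩, ⟨p, Piece.cap⟩] []
  /-- An input disc may be rotated by `2π`: all its strings, pulled once around the disc from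
  left to right, passing below it, may be released. -/
  | rotate (p : ℕ) (t : Bool) (n : ℕ) (v : P t n) :
      Move (cups p (2 * n) ++ ⟨p + 2 * n, Piece.box t n v⟩ :: caps p (2 * n))
        [⟨p, Piece.box t n v⟩]

theorem fits_append {s : Bool} {w w' : Word P} {m m₁ m' : ℕ} (h : Fits s w m m₁)
    (h' : Fits s w' m₁ m') : Fits s (w ++ w') m m' := by
  induction w generalizing m with
  | nil => cases h; exact h'
  | cons l w ih => exact ⟨h.1, h.2.1, ih h.2.2⟩

theorem fits_cups (s : Bool) (p j m : ℕ) (hp : p ≤ m) :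
    Fits s (cups p j : Word P) m (m + 2 * j) := by
  induction j generalizing p m with
  | zero => rfl
  | succ j ih =>
    refine ⟨hp, trivial, ?_⟩
    have := ih (p + 1) (m + 2) (by omega)
    rwa [show m + 2 * (j + 1) = m + 2 + 2 * j by ring]

theorem fits_caps (s : Bool) (p j m : ℕ) (hp : p + j + j ≤ m + 2 * j) :
    Fits s (caps p j : Word P) (m + 2 * j) m := by
  induction j with
  | zero => rfl
  | succ j ih =>
    refine ⟨?_, trivial, ?_⟩
    · change p + j + 2 ≤ _
      omega
    · have := ih (by omega)
      rwa [show m + 2 * (j + 1) - (Piece.cap : Piece P).inp + (Piece.cap : Piece P).out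
        = m + 2 * j by simp only [Piece.inp, Piece.out]; omega]

theorem fits_reflect (f : ∀ {s : Bool} {n : ℕ}, P s n → P s n) {s : Bool} {w : Word P} {m m' : ℕ}
    (hm : Even m) (h : Fits s w m m') : Fits s (reflect f m w) m m' := by
  induction w generalizing m with
  | nil => exact h
  | cons l w ih =>
    obtain ⟨p, g⟩ := l
    obtain ⟨h1, h2, h3⟩ := h
    cases g with
    | cup => exact ⟨Nat.sub_le _ _, trivial, ih (by simp [Piece.inp, Piece.out, hm, parity_simps]) h3⟩
    | cap =>
      simp only [Piece.inp] at h1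
      refine ⟨?_, trivial, ih ?_ h3⟩
      · simp only [Piece.inp, Piece.map]; omega
      · simp only [Piece.inp, Piece.out]
        rw [Nat.even_iff] at hm ⊢; omega
    | box t n v =>
      simp only [Piece.inp] at h1
      refine ⟨Nat.sub_le _ _, ?_, ih ?_ h3⟩
      · simp only [Piece.Allowed, Piece.inp, Piece.map, regionColour] at h2 ⊢
        have : Even (m - 0 - p) ↔ Even p := by
          rw [Nat.even_iff] at hm ⊢; rw [Nat.even_iff]; omega
        simpa only [this] using h2
      · simp only [Piece.inp, Piece.out]
        rw [Nat.even_iff] at hm ⊢; omega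

end Word

/-- Labelled shaded planar tangles whose outer disc has `2 * n` marked points and its distinguished
interval in a region of colour `s`. -/
def Tangle (P : Bool → ℕ → Type u) (s : Bool) (n : ℕ) : Type u :=
  {w : Word P // Word.Fits s w 0 (2 * n)}

namespace Tangle

variable {P : Bool → ℕ → Type u}

/-- Planar isotopy: the equivalence relation generated by the elementary isotopies, applied
anywhere inside a tangle. -/
def Isotopic {s : Bool} {n : ℕ} : Tangle P s n → Tangle P s n → Prop :=
  Relation.EqvGen fun T T' => ∃ u x y v : Word P,
    Word.Move x y ∧ T.1 = u ++ x ++ v ∧ T'.1 = u ++ y ++ v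

/-- The empty tangle. -/
def empty (s : Bool) : Tangle P s 0 := ⟨[], rfl⟩

/-- The tangle with nothing but a loop. -/
def loop (s : Bool) : Tangle P s 0 := ⟨[⟨0, Piece.cup⟩, ⟨0, Piece.cap⟩], by
  simp [Word.Fits, Piece.inp, Piece.out, Piece.Allowed]⟩

/-- The identity tangle: a single input disc joined to the outer disc by straight strings. -/
def single {s : Bool} {n : ℕ} (v : P s n) : Tangle P s n := ⟨[⟨0, Piece.box s n v⟩], by
  simp [Word.Fits, Piece.inp, Piece.out, Piece.Allowed, regionColour]⟩

/-- The closure of a disc with two marked points by one string, with the distinguished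
interval in the outer region. -/
def closeRight {s : Bool} (v : P s 1) : Tangle P s 0 :=
  ⟨[⟨0, Piece.box s 1 v⟩, ⟨0, Piece.cap⟩], by
    simp [Word.Fits, Piece.inp, Piece.out, Piece.Allowed, regionColour]⟩

/-- The closure of a disc with two marked points by one string, with the distinguished
interval in the inner region. -/
def closeLeft {s : Bool} (v : P s 1) : Tangle P (!s) 0 :=
  ⟨[⟨0, Piece.cup⟩, ⟨1, Piece.box s 1 v⟩, ⟨0, Piece.cap⟩, ⟨0, Piece.cap⟩], by
    simp [Word.Fits, Piece.inp, Piece.out, Piece.Allowed, regionColour]⟩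

/-- Two discs, side by side, each marked point of one being joined to the mirror image of that marked
point on the other. -/
def pairing {s : Bool} {n : ℕ} (v w : P s n) : Tangle P s 0 :=
  ⟨[⟨0, Piece.box s n v⟩, ⟨2 * n, Piece.box s n w⟩] ++ Word.caps 0 (2 * n), by
    refine Word.fits_append (m₁ := 0 + 2 * (2 * n)) ?_ (Word.fits_caps _ _ _ _ (by omega))
    simp [Word.Fits, Piece.inp, Piece.out, Piece.Allowed, regionColour]
    omega⟩

/-- Reflection of a tangle in a vertical line, the labels being changed by `f`. -/
def reflect (f : ∀ {s : Bool} {n : ℕ}, P s n → P s n) {s : Bool} {n : ℕ} (T : Tangle P s n) :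
    Tangle P s n :=
  ⟨Word.reflect f 0 T.1, Word.fits_reflect f (by simp) T.2⟩

/-- The rotation tangle which moves the last `2 * j` of the `2 * (j + l)` marked points of a
disc to the first places. -/
def rotation {s : Bool} (j l : ℕ) (v : P s (j + l)) : Tangle P s (j + l) :=
  ⟨Word.cups 0 (2 * j) ++ ([⟨2 * j, Piece.box s (j + l) v⟩] ++ Word.caps (2 * j + 2 * l) (2 * j)), by
    refine Word.fits_append (Word.fits_cups _ _ _ _ le_rfl) (Word.fits_append
      (m₁ := 2 * (j + l) + 2 * (2 * j)) ?_ (Word.fits_caps _ _ _ _ (by omega)))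
    simp [Word.Fits, Piece.inp, Piece.out, Piece.Allowed, regionColour]
    omega⟩

/-- The `i`-th tangle in the product of `v ∈ P_{m,k}` and `w ∈ P_{n,k}`. The marked points of a disc
of `P_{n,k}` are, in clockwise order from the distinguished interval (top left corner):
`2 * n` points on the top edge, `k` on the right edge, `k` on the left edge. The
last `i` top points of `v` are joined to the first `i` top points of `w`, and the right
points of `v` to the left points of `w`, by parallel strings; the remaining points go to the points
of the outer disc in the order: top of `v`, top of `w`, right of `w`, left of `v`.
Here `w` is drawn in the region touching the top right corner of `v`. -/
def product {s : Bool} (k m n i : ℕ) (hm : i ≤ 2 * m) (hn : i ≤ 2 * n)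
    (v : P s (m + k)) (w : P s (n + k)) : Tangle P s (m + n - i + k) :=
  ⟨[⟨0, Piece.box s (m + k) v⟩, ⟨2 * m, Piece.box s (n + k) w⟩] ++
      (Word.caps (2 * m - i) i ++ Word.caps ((2 * m - i) + (2 * n - i) + k) k), by
    refine Word.fits_append (m₁ := (2 * (m + n - i + k) + 2 * k) + 2 * i) ?_ (Word.fits_append
      (Word.fits_caps _ _ _ _ (by omega)) (Word.fits_caps _ _ _ _ (by omega)))
    simp [Word.Fits, Piece.inp, Piece.out, Piece.Allowed, regionColour]
    omega⟩

end Tangle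

/-- A (shaded, complex) planar algebra: vector spaces `P s n`, where `s` is the colour of the
distinguished interval and `2 * n` the number of marked points, and an action `Z` of labelled planar
tangles on them which is multilinear in the labels, invariant under isotopy, and compatible with
the gluing of tangles into input discs. -/
structure PlanarAlgebra where
  P : Bool → ℕ → Type u
  [addCommGroup : ∀ s n, AddCommGroup (P s n)]
  [module : ∀ s n, Module ℂ (P s n)]
  Z : ∀ {s : Bool} {n : ℕ}, Tangle P s n → P s n
  Z_add : ∀ {s : Bool} {n : ℕ} (a b : Word P) (p : ℕ) (t : Bool) (l : ℕ) (x y : P t l)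
    (h : Word.Fits s (a ++ ⟨p, Piece.box t l (x + y)⟩ :: b) 0 (2 * n))
    (hx : Word.Fits s (a ++ ⟨p, Piece.box t l x⟩ :: b) 0 (2 * n))
    (hy : Word.Fits s (a ++ ⟨p, Piece.box t l y⟩ :: b) 0 (2 * n)),
    Z ⟨_, h⟩ = Z ⟨_, hx⟩ + Z ⟨_, hy⟩
  Z_smul : ∀ {s : Bool} {n : ℕ} (a b : Word P) (p : ℕ) (t : Bool) (l : ℕ) (c : ℂ) (x : P t l)
    (h : Word.Fits s (a ++ ⟨p, Piece.box t l (c • x)⟩ :: b) 0 (2 * n))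
    (hx : Word.Fits s (a ++ ⟨p, Piece.box t l x⟩ :: b) 0 (2 * n)),
    Z ⟨_, h⟩ = c • Z ⟨_, hx⟩
  Z_isotopy : ∀ {s : Bool} {n : ℕ} (T T' : Tangle P s n), Tangle.Isotopic T T' → Z T = Z T'
  Z_single : ∀ {s : Bool} {n : ℕ} (v : P s n), Z (Tangle.single v) = v
  Z_glue : ∀ {s : Bool} {n : ℕ} (a b : Word P) (p : ℕ) (t : Bool) (l : ℕ) (U : Tangle P t l)
    (h : Word.Fits s (a ++ ⟨p, Piece.box t l (Z U)⟩ :: b) 0 (2 * n))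
    (h' : Word.Fits s (a ++ (Word.shift p U.1 ++ b)) 0 (2 * n)),
    Z ⟨_, h⟩ = Z ⟨_, h'⟩

attribute [instance] PlanarAlgebra.addCommGroup PlanarAlgebra.module

/-- A planar star-algebra: a planar algebra with conjugate linear involutions that are compatible
with the reflection of tangles. -/
structure PlanarStarAlgebra extends PlanarAlgebra.{u} where
  adj : ∀ {s : Bool} {n : ℕ}, P s n → P s n
  adj_add : ∀ {s : Bool} {n : ℕ} (x y : P s n), adj (x + y) = adj x + adj y
  adj_smul : ∀ {s : Bool} {n : ℕ} (c : ℂ) (x : P s n), adj (c • x) = (starRingEnd ℂ c) • adj x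
  adj_adj : ∀ {s : Bool} {n : ℕ} (x : P s n), adj (adj x) = x
  adj_Z : ∀ {s : Bool} {n : ℕ} (T : Tangle P s n), adj (Z T) = Z (Tangle.reflect adj T)

namespace PlanarStarAlgebra

open scoped Classical in
/-- The scalar `c` such that `x` is `c` times the empty tangle. It exists and is unique when the space
`P s 0` is one-dimensional; this is the identification of `P s 0` with `ℂ`. -/
noncomputable def scalar (A : PlanarStarAlgebra.{u}) {s : Bool} (x : A.P s 0) : ℂ :=
  if h : ∃ c : ℂ, x = c • A.Z (Tangle.empty s) then h.choose else 0

/-- The sesquilinear form of a planar star-algebra: join `x` to the reflection of `y`. -/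
noncomputable def form (A : PlanarStarAlgebra.{u}) {s : Bool} {n : ℕ} (x y : A.P s n) : ℂ :=
  A.scalar (A.Z (Tangle.pairing x (A.adj y)))

/-- Subfactor planar algebras: the spaces are finite dimensional, the two spaces without marked
points are one-dimensional, closed tangles are invariant under isotopies of the sphere, and the
sesquilinear form is positive definite. -/
structure IsSubfactor (A : PlanarStarAlgebra.{u}) : Prop where
  finiteDimensional : ∀ s n, FiniteDimensional ℂ (A.P s n)
  finrank_zero : ∀ s, Module.finrank ℂ (A.P s 0) = 1
  spherical : ∀ (s : Bool) (x : A.P s 1),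
    A.scalar (A.Z (Tangle.closeRight x)) = A.scalar (A.Z (Tangle.closeLeft x))
  form_pos : ∀ (s : Bool) (n : ℕ) (x : A.P s n), x ≠ 0 → 0 < (A.form x x).re ∧ (A.form x x).im = 0

/-- The value `δ` of a loop. -/
noncomputable def delta (A : PlanarStarAlgebra.{u}) : ℂ :=
  A.scalar (A.Z (Tangle.loop true))

/-- The graded vector space `⨁ n, P_{n,k}`, where `P_{n,k} = P_{n+k}`. -/
abbrev Gr (A : PlanarStarAlgebra.{u}) (k : ℕ) : Type u :=
  DirectSum ℕ fun n => A.P true (n + k)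

/-- The `i`-th term of the product, as a bilinear map. -/
def productTerm (A : PlanarStarAlgebra.{u}) (k m n i : ℕ) (hm : i ≤ 2 * m) (hn : i ≤ 2 * n) :
    A.P true (m + k) →ₗ[ℂ] A.P true (n + k) →ₗ[ℂ] A.P true (m + n - i + k) :=
  LinearMap.mk₂ ℂ (fun v w => A.Z (Tangle.product k m n i hm hn v w))
    (fun _ _ w => A.Z_add [] (⟨2 * m, Piece.box true (n + k) w⟩ :: _) 0 true _ _ _ _ _ _)
    (fun _ _ w => A.Z_smul [] (⟨2 * m, Piece.box true (n + k) w⟩ :: _) 0 true _ _ _ _ _)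
    (fun v _ _ => A.Z_add [⟨0, Piece.box true (m + k) v⟩] _ (2 * m) true _ _ _ _ _ _)
    (fun _ v _ => A.Z_smul [⟨0, Piece.box true (m + k) v⟩] _ (2 * m) true _ _ _ _ _)

/-- The product of homogeneous elements: the sum over `0 ≤ i ≤ min (2 * m) (2 * n)` of the terms with
`i` strings between the top edges, the `i`-th term having degree `m + n - i`. -/
noncomputable def homMul (A : PlanarStarAlgebra.{u}) (k m n : ℕ) :
    A.P true (m + k) →ₗ[ℂ] A.P true (n + k) →ₗ[ℂ] A.Gr k :=
  ∑ i : Fin (min (2 * m) (2 * n) + 1),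
    (A.productTerm k m n i (by omega) (by omega)).compr₂
      (DirectSum.lof ℂ ℕ (fun n => A.P true (n + k)) (m + n - i))

/-- The product `a ⋆ b` of `Gr k`. -/
noncomputable def grMul (A : PlanarStarAlgebra.{u}) (k : ℕ) :
    A.Gr k →ₗ[ℂ] A.Gr k →ₗ[ℂ] A.Gr k :=
  DirectSum.toModule ℂ ℕ _ fun m =>
    (DirectSum.toModule ℂ ℕ _ fun n => (A.homMul k m n).flip).flip

/-- The involution on `P_{n,k}`: the disc is reflected in a vertical line, which exchanges the
left and the right edge; since this moves the distinguished interval to the top right corner, a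
rotation brings it back to the top left corner. -/
def homStar (A : PlanarStarAlgebra.{u}) (k n : ℕ) (x : A.P true (n + k)) : A.P true (n + k) :=
  A.Z (Tangle.rotation n k (A.adj x))

theorem homStar_zero (A : PlanarStarAlgebra.{u}) (k n : ℕ) : A.homStar k n 0 = 0 := by
  have h0 : A.adj (0 : A.P true (n + k)) = (0 : ℂ) • (0 : A.P true (n + k)) := by
    have := A.adj_smul 0 (0 : A.P true (n + k))
    simpa using this
  unfold homStar
  rw [h0]
  exact (A.Z_smul (Word.cups 0 (2 * n)) _ (2 * n) true (n + k) 0 0 _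
    (Tangle.rotation n k (0 : A.P true (n + k))).2).trans (zero_smul _ _)

/-- The involution of `Gr k`, degree by degree. -/
noncomputable def grStar (A : PlanarStarAlgebra.{u}) (k : ℕ) (a : A.Gr k) : A.Gr k :=
  DFinsupp.mapRange (fun n => A.homStar k n) (fun n => A.homStar_zero k n) a

open scoped Classical in
/-- The inner product of `Gr k`, linear in the first variable: different degrees are
orthogonal, and within `P_{n,k}` it is `δ⁻ᵏ` times the form of the planar algebra. -/
noncomputable def grInner (A : PlanarStarAlgebra.{u}) (k : ℕ) (a b : A.Gr k) : ℂ :=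
  ∑ n ∈ DFinsupp.support a, (A.delta ^ k)⁻¹ * A.form (a n) (b n)

end PlanarStarAlgebra

/-- The norm of a positive semidefinite form. -/
noncomputable def formNorm {V : Type*} (ip : V → V → ℂ) (x : V) : ℝ := Real.sqrt (ip x x).re

/-- `V`, with product `mul`, involution `inv` and inner product `ip` (linear in the first variable), is
a Hilbert algebra. -/
structure IsHilbertAlgebra {V : Type*} [AddCommGroup V] [Module ℂ V]
    (mul : V → V → V) (inv : V → V) (ip : V → V → ℂ) : Prop where
  add_mul : ∀ x y z, mul (x + y) z = mul x z + mul y z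
  mul_add : ∀ x y z, mul x (y + z) = mul x y + mul x z
  smul_mul : ∀ (c : ℂ) x y, mul (c • x) y = c • mul x y
  mul_smul : ∀ (c : ℂ) x y, mul x (c • y) = c • mul x y
  mul_assoc : ∀ x y z, mul (mul x y) z = mul x (mul y z)
  inv_add : ∀ x y, inv (x + y) = inv x + inv y
  inv_smul : ∀ (c : ℂ) x, inv (c • x) = (starRingEnd ℂ c) • inv x
  inv_inv : ∀ x, inv (inv x) = x
  inv_mul : ∀ x y, inv (mul x y) = mul (inv y) (inv x)
  ip_add_left : ∀ x y z, ip (x + y) z = ip x z + ip y z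
  ip_smul_left : ∀ (c : ℂ) x y, ip (c • x) y = c * ip x y
  ip_conj : ∀ x y, (starRingEnd ℂ) (ip x y) = ip y x
  ip_pos : ∀ x, x ≠ 0 → 0 < (ip x x).re
  ip_inv : ∀ x y, ip (inv y) (inv x) = ip x y
  ip_mul_left : ∀ x y z, ip (mul x y) z = ip y (mul (inv x) z)
  bounded : ∀ x, ∃ C : ℝ, ∀ y, formNorm ip (mul x y) ≤ C * formNorm ip y
  dense : ∀ x, ∀ ε : ℝ, 0 < ε →
    ∃ y ∈ Submodule.span ℂ {z | ∃ v w, z = mul v w}, formNorm ip (x - y) < ε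

/-! The algebraic identities are planar isotopies together with their formal consequences.
Boundedness comes from one finite-dimensional algebra acting on all degrees at once.

Algebra. In `(a ⋆ b) ⋆ c` and `a ⋆ (b ⋆ c)` the terms correspond once the numbers of top strings
between each two factors are prescribed (`term_assoc`, `sum_term_assoc`), and `k` parallel strings
form a unit. Two pictures govern the involution. In `form_term`, sphericity carries the top strings
of `a` to the other side, which gives `⟨a ⋆ x, y⟩ = ⟨x, a* ⋆ y⟩`. In `form_homStar`, a rotation of a
disc by `2π` gives `⟨b, a*⟩ = ⟨b ⋆ a, 1⟩`. The other laws relating the involution to product and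
inner product follow from these, the unit and nondegeneracy. Density is immediate from the unit.

Boundedness. Fix `a` of degree `m` and the number `i` of joined top strings. Adjointness and
associativity give `‖(a ⋆ x)_i‖² = ⟨x, c · x⟩` with `c = (a* ⋆ a)_{2m-i}` in `P_{i,k}`, where
`P_{i,k}` acts on every `P_{n,k}` by joining `i` strings. The functional `φ(y) = ⟨y · x, x⟩` on
`P_{i,k}` satisfies `|φ(y)|² ≤ ‖x‖² |φ(y* y)|`. On a finite-dimensional space this alone bounds `φ`
by a constant times `‖x‖²`, uniformly in `n` and `x` (`exists_bound_of_sq_le`). For fixed `i`,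
different degrees `n` have orthogonal images, so the bound passes to `Gr k` by Pythagoras; only the
`2m + 1` values of `i` remain to be summed. -/

/-! ### Planar isotopy of stacks of layers -/

namespace Word

variable {P : Bool → ℕ → Type u}

/-- The number of strings at the top of a stack on `m` strings. -/
def ht : Word P → ℕ → ℕ
  | [], m => m
  | l :: w, m => ht w (m - l.piece.inp + l.piece.out)

@[simp] theorem ht_nil (m : ℕ) : ht ([] : Word P) m = m := rfl

@[simp] theorem ht_cons (l : Layer P) (w : Word P) (m : ℕ) :
    ht (l :: w) m = ht w (m - l.piece.inp + l.piece.out) := rfl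

@[simp] theorem ht_append (u v : Word P) (m : ℕ) : ht (u ++ v) m = ht v (ht u m) := by
  induction u generalizing m with
  | nil => rfl
  | cons l u ih => simp [ih]

theorem Fits.ht_eq {s : Bool} {w : Word P} {m m' : ℕ} (h : Fits s w m m') : ht w m = m' := by
  induction w generalizing m with
  | nil => exact h
  | cons l w ih => exact ih h.2.2

theorem fits_append_iff {s : Bool} {u v : Word P} {m m' : ℕ} :
    Fits s (u ++ v) m m' ↔ Fits s u m (ht u m) ∧ Fits s v (ht u m) m' := by
  induction u generalizing m with
  | nil => simp [Fits]
  | cons l u ih => simp [Fits, ih, and_assoc]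

/-- An elementary isotopy inside a stack on `m` strings. -/
def Step (m : ℕ) (w w' : Word P) : Prop :=
  ∃ u x y v, Move x y ∧ (∀ s m', Fits s x (ht u m) m' ↔ Fits s y (ht u m) m') ∧
    w = u ++ x ++ v ∧ w' = u ++ y ++ v

/-- Planar isotopy of stacks on `m` strings. -/
def Iso (m : ℕ) : Word P → Word P → Prop := Relation.EqvGen (Step m)

namespace Iso

variable {m : ℕ} {w w' w'' : Word P}

theorem refl (w : Word P) : Iso m w w := Relation.EqvGen.refl w

theorem symm (h : Iso m w w') : Iso m w' w := Relation.EqvGen.symm _ _ h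

theorem trans (h : Iso m w w') (h' : Iso m w' w'') : Iso m w w'' :=
  Relation.EqvGen.trans _ _ _ h h'

theorem of_move {x y : Word P} (h : Move x y)
    (hf : ∀ s m', Fits s x m m' ↔ Fits s y m m') : Iso m x y :=
  Relation.EqvGen.rel _ _ ⟨[], x, y, [], h, hf, by simp, by simp⟩

theorem append_right (h : Iso m w w') (v : Word P) : Iso m (w ++ v) (w' ++ v) := by
  induction h with
  | rel _ _ h =>
    obtain ⟨u, x, y, v', hm, hf, rfl, rfl⟩ := h
    exact Relation.EqvGen.rel _ _ ⟨u, x, y, v' ++ v, hm, hf, by simp, by simp⟩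
  | refl => exact refl _
  | symm _ _ _ ih => exact ih.symm
  | trans _ _ _ _ _ ih ih' => exact ih.trans ih'

theorem append_left (u : Word P) (h : Iso (ht u m) w w') : Iso m (u ++ w) (u ++ w') := by
  induction h with
  | rel _ _ h =>
    obtain ⟨u', x, y, v, hm, hf, rfl, rfl⟩ := h
    exact Relation.EqvGen.rel _ _ ⟨u ++ u', x, y, v, hm, by simpa using hf, by simp, by simp⟩
  | refl => exact refl _
  | symm _ _ _ ih => exact ih.symm
  | trans _ _ _ _ _ ih ih' => exact ih.trans ih'

theorem cons (l : Layer P) (h : Iso (m - l.piece.inp + l.piece.out) w w') :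
    Iso m (l :: w) (l :: w') := append_left [l] h

end Iso

end Word

theorem regionColour_congr {s : Bool} {p q : ℕ} (h : p % 2 = q % 2) :
    regionColour s p = regionColour s q := by
  simp only [regionColour, Nat.even_iff, h]

theorem Piece.inp_out_even {P : Bool → ℕ → Type u} (g : Piece P) :
    g.inp % 2 = 0 ∧ g.out % 2 = 0 := by
  cases g <;> simp [Piece.inp, Piece.out]

theorem Piece.allowed_congr {P : Bool → ℕ → Type u} (g : Piece P) {s : Bool} {p q : ℕ}
    (h : p % 2 = q % 2) : g.Allowed (regionColour s p) ↔ g.Allowed (regionColour s q) := by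
  rw [regionColour_congr h]

namespace Word

variable {P : Bool → ℕ → Type u}

theorem Iso.swap_layers (m p q : ℕ) (g h : Piece P) (hq : p + g.out ≤ q) :
    Iso m [⟨p, g⟩, ⟨q, h⟩] [⟨q - g.out + g.inp, h⟩, ⟨p, g⟩] := by
  obtain ⟨r, rfl⟩ := Nat.exists_eq_add_of_le hq
  rw [show p + g.out + r - g.out + g.inp = p + g.inp + r by omega]
  refine Iso.of_move (Move.exchange p r g h) fun s m' => ?_
  have hg := g.inp_out_even
  have hh := h.inp_out_even
  have e := h.allowed_congr (s := s) (p := p + g.out + r) (q := p + g.inp + r) (by omega)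
  simp only [Fits, e]
  constructor
  · rintro ⟨h1, h2, h3, h4, h5⟩
    exact ⟨by omega, h4, by omega, h2, by omega⟩
  · rintro ⟨h1, h2, h3, h4, h5⟩
    exact ⟨by omega, h4, by omega, h2, by omega⟩

theorem cups_add (p i j : ℕ) : (cups p (i + j) : Word P) = cups p i ++ cups (p + i) j := by
  induction i generalizing p with
  | zero => simp [cups]
  | succ i ih =>
    rw [show i + 1 + j = (i + j) + 1 by ring]
    simp only [cups, ih, List.cons_append]
    rw [show p + 1 + i = p + (i + 1) by ring]

theorem caps_add (p i j : ℕ) : (caps p (i + j) : Word P) = caps (p + j) i ++ caps p j := by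
  induction i with
  | zero => simp [caps]
  | succ i ih =>
    rw [show i + 1 + j = (i + j) + 1 by ring]
    simp only [caps, ih, List.cons_append]
    rw [show p + (i + j) = p + j + i by ring]

theorem ht_cups (p j m : ℕ) : ht (cups p j : Word P) m = m + 2 * j := by
  induction j generalizing p m with
  | zero => rfl
  | succ j ih => simp only [cups, ht_cons, ih, Piece.inp, Piece.out]; omega

theorem ht_caps (p j m : ℕ) : ht (caps p j : Word P) m = m - 2 * j := by
  induction j generalizing m with
  | zero => rfl
  | succ j ih => simp only [caps, ht_cons, ih, Piece.inp, Piece.out]; omega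

theorem shift_cups (a p j : ℕ) : shift a (cups p j : Word P) = cups (a + p) j := by
  induction j generalizing p with
  | zero => rfl
  | succ j ih =>
    rw [cups, shift, List.map_cons]
    exact congrArg _ (ih (p + 1))

theorem shift_caps (a p j : ℕ) : shift a (caps p j : Word P) = caps (a + p) j := by
  induction j with
  | zero => rfl
  | succ j ih =>
    simp only [caps, shift, List.map_cons, add_assoc] at *
    rw [ih]

theorem shift_append (a : ℕ) (u v : Word P) : shift a (u ++ v) = shift a u ++ shift a v := by
  simp [shift]

theorem reflect_append (f : ∀ {s : Bool} {n : ℕ}, P s n → P s n) (m : ℕ) (u v : Word P) :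
    reflect f m (u ++ v) = reflect f m u ++ reflect f (ht u m) v := by
  induction u generalizing m with
  | nil => rfl
  | cons l u ih => simp [reflect, ih]

theorem reflect_cups (f : ∀ {s : Bool} {n : ℕ}, P s n → P s n) {m p : ℕ} (j : ℕ) (hp : p ≤ m) :
    reflect f m (cups p j : Word P) = cups (m - p) j := by
  induction j generalizing p m with
  | zero => rfl
  | succ j ih =>
    simp only [cups, reflect, Piece.inp, Piece.out, Piece.map]
    rw [ih (by omega), show m - 0 + 2 - (p + 1) = m - p + 1 by omega, Nat.sub_zero]

theorem reflect_caps (f : ∀ {s : Bool} {n : ℕ}, P s n → P s n) {m p j : ℕ} (hp : p + 2 * j ≤ m) :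
    reflect f m (caps p j : Word P) = caps (m - p - 2 * j) j := by
  induction j generalizing m with
  | zero => rfl
  | succ j ih =>
    simp only [caps, reflect, Piece.inp, Piece.out, Piece.map]
    rw [ih (by omega), show m - 2 - (p + j) = m - p - 2 * (j + 1) + j by omega,
      show m - 2 + 0 - p - 2 * j = m - p - 2 * (j + 1) by omega]

end Word

/-! ### Diagram calculus with bundles of parallel strings -/

/-- The blocks of a diagram: nested minima, nested maxima, and input discs. -/
inductive Blk (P : Bool → ℕ → Type u) : Type u
  | C (j : ℕ) : Blk P
  | K (j : ℕ) : Blk P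
  | B {t : Bool} {n : ℕ} (v : P t n) : Blk P

/-- A stack of blocks, each with its position. -/
abbrev Diag (P : Bool → ℕ → Type u) : Type u := List (ℕ × Blk P)

namespace Blk

variable {P : Bool → ℕ → Type u}

/-- Number of strings entering a block. -/
def inp : Blk P → ℕ
  | C _ => 0
  | K j => 2 * j
  | B _ => 0

/-- Number of strings leaving a block. -/
def out : Blk P → ℕ
  | C j => 2 * j
  | K _ => 0
  | B (n := n) _ => 2 * n

/-- The block may be put into a region of colour `c`. -/
def Allowed (c : Bool) : Blk P → Prop
  | C _ => True
  | K _ => True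
  | B (t := t) _ => t = c

/-- The stack of layers of a block at position `p`. -/
def word (p : ℕ) : Blk P → Word P
  | C j => Word.cups p j
  | K j => Word.caps p j
  | B (t := t) (n := n) v => [⟨p, Piece.box t n v⟩]

/-- Apply an operation to the label. -/
def map (f : ∀ {s : Bool} {n : ℕ}, P s n → P s n) : Blk P → Blk P
  | C j => C j
  | K j => K j
  | B v => B (f v)

theorem ht_word (p m : ℕ) (g : Blk P) : Word.ht (g.word p) m = m - g.inp + g.out := by
  cases g with
  | C j => simp [word, Word.ht_cups, inp, out]
  | K j => simp [word, Word.ht_caps, inp, out]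
  | B v => rfl

theorem fits_word {s : Bool} {p m : ℕ} {g : Blk P} (h : p + g.inp ≤ m)
    (hg : g.Allowed (regionColour s p)) :
    Word.Fits s (g.word p) m (m - g.inp + g.out) := by
  cases g with
  | C j => exact Word.fits_cups s p j m h
  | K j =>
    simp only [inp] at h
    have := Word.fits_caps (P := P) s p j (m - 2 * j) (by omega)
    rwa [Nat.sub_add_cancel (by omega)] at this
  | B v => exact ⟨h, hg, rfl⟩

theorem shift_word (a p : ℕ) (g : Blk P) : Word.shift a (g.word p) = g.word (a + p) := by
  cases g with
  | C j => exact Word.shift_cups a p j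
  | K j => exact Word.shift_caps a p j
  | B v => rfl

theorem reflect_word (f : ∀ {s : Bool} {n : ℕ}, P s n → P s n) {m p : ℕ} {g : Blk P}
    (h : p + g.inp ≤ m) :
    Word.reflect f m (g.word p) = (g.map f).word (m - g.inp - p) := by
  cases g with
  | C j => exact Word.reflect_cups f j h
  | K j =>
    simp only [inp] at h
    simp only [word, map, inp]
    rw [Word.reflect_caps f h, Nat.sub_right_comm]
  | B v => rfl

theorem swap_layer (m p q : ℕ) (g : Piece P) (h : Blk P) (hq : p + g.out ≤ q) :
    Word.Iso m (⟨p, g⟩ :: h.word q) (h.word (q - g.out + g.inp) ++ [⟨p, g⟩]) := by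
  cases h with
  | B v => exact Word.Iso.swap_layers m p q g _ hq
  | C j =>
    induction j generalizing m q with
    | zero => exact .refl _
    | succ j ih =>
      refine ((Word.Iso.swap_layers m p q g .cup hq).append_right (Word.cups (q + 1) j)).trans ?_
      refine Word.Iso.cons _ ((ih _ (q + 1) (by omega)).trans ?_)
      rw [show q + 1 - g.out + g.inp = q - g.out + g.inp + 1 by omega]
      exact .refl _
  | K j =>
    induction j generalizing m with
    | zero => exact .refl _
    | succ j ih =>
      refine ((Word.Iso.swap_layers m p (q + j) g .cap (by omega)).append_right
        (Word.caps q j)).trans ?_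
      rw [show q + j - g.out + g.inp = q - g.out + g.inp + j by omega]
      exact Word.Iso.cons _ (ih _)

/-- The layers of `g` are passed one at a time, each past the whole block `h` by `swap_layer`; the
position of `h` changes by the strings that each layer creates or removes. -/
theorem swap_word (m p q : ℕ) (g h : Blk P) (hq : p + g.out ≤ q) :
    Word.Iso m (g.word p ++ h.word q) (h.word (q - g.out + g.inp) ++ g.word p) := by
  cases g with
  | B v => exact swap_layer m p q _ h hq
  | C j =>
    induction j generalizing m p with
    | zero => simpa [word, Word.cups, inp, out] using Word.Iso.refl _
    | succ j ih =>
      simp only [out, inp, add_zero] at *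
      refine (Word.Iso.cons ⟨p, .cup⟩ (ih _ (p + 1) (by omega))).trans ?_
      refine ((swap_layer m p (q - 2 * j) .cup h (by simp only [Piece.out]; omega)).append_right
        (Word.cups (p + 1) j)).trans ?_
      simp only [Piece.out, Piece.inp, List.append_assoc, add_zero]
      rw [show q - 2 * j - 2 = q - 2 * (j + 1) by omega]
      exact .refl _
  | K j =>
    induction j generalizing m with
    | zero => simpa [word, Word.caps, inp, out] using Word.Iso.refl _
    | succ j ih =>
      simp only [out, inp, add_zero, Nat.sub_zero] at *
      refine (Word.Iso.cons ⟨p + j, .cap⟩ (ih _ hq)).trans ?_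
      refine ((swap_layer m (p + j) (q + 2 * j) .cap h
        (by simp only [Piece.out]; omega)).append_right (Word.caps p j)).trans ?_
      simp only [Piece.out, Piece.inp, List.append_assoc, Nat.sub_zero]
      exact .refl _

end Blk

namespace Diag

variable {P : Bool → ℕ → Type u}

open Blk

/-- The stack of layers of a stack of blocks. -/
def word : Diag P → Word P
  | [] => []
  | x :: d => x.2.word x.1 ++ word d

/-- The number of strings at the top of a stack of blocks on `m` strings. -/
def ht : Diag P → ℕ → ℕ
  | [], m => m
  | x :: d, m => ht d (m - x.2.inp + x.2.out)

/-- The stack of blocks can be put on top of `m` strings. -/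
def Ok (s : Bool) : Diag P → ℕ → Prop
  | [], _ => True
  | x :: d, m => x.1 + x.2.inp ≤ m ∧ x.2.Allowed (regionColour s x.1) ∧
      Ok s d (m - x.2.inp + x.2.out)

/-- Add strings on the left. -/
def shift (a : ℕ) : Diag P → Diag P
  | [] => []
  | x :: d => (a + x.1, x.2) :: shift a d

/-- Reflection in a vertical line. -/
def reflect (f : ∀ {s : Bool} {n : ℕ}, P s n → P s n) : ℕ → Diag P → Diag P
  | _, [] => []
  | m, x :: d => (m - x.2.inp - x.1, x.2.map f) :: reflect f (m - x.2.inp + x.2.out) d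

@[simp] theorem word_append (d e : Diag P) : word (d ++ e) = word d ++ word e := by
  induction d with
  | nil => rfl
  | cons x d ih => simp [word, ih]

theorem word_shift (a : ℕ) (d : Diag P) : word (shift a d) = Word.shift a (word d) := by
  induction d with
  | nil => rfl
  | cons x d ih => simp [word, shift, ih, Word.shift_append, shift_word]

theorem fits_word {s : Bool} {d : Diag P} {m m' : ℕ} (h : Ok s d m) (hm : ht d m = m') :
    Word.Fits s (word d) m m' := by
  induction d generalizing m with
  | nil => exact hm
  | cons x d ih => exact Word.fits_append (Blk.fits_word h.1 h.2.1) (ih h.2.2 hm)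

theorem word_reflect (f : ∀ {s : Bool} {n : ℕ}, P s n → P s n) {s : Bool} {d : Diag P} {m : ℕ}
    (h : Ok s d m) : word (reflect f m d) = Word.reflect f m (word d) := by
  induction d generalizing m with
  | nil => rfl
  | cons x d ih =>
    simp only [word, reflect, Word.reflect_append, ht_word]
    rw [ih h.2.2, Blk.reflect_word f h.1]

/-- Planar isotopy of stacks of blocks on `m` strings. -/
def Iso (m : ℕ) (d e : Diag P) : Prop := Word.Iso m (word d) (word e)

namespace Iso

variable {m : ℕ} {d d' d'' : Diag P}

theorem refl (d : Diag P) : Iso m d d := Word.Iso.refl _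

theorem of_eq (h : d = d') : Iso m d d' := h ▸ refl d

theorem of_word_eq (h : word d = word d') : Iso m d d' := by
  unfold Iso; rw [h]; exact .refl _

theorem symm (h : Iso m d d') : Iso m d' d := Word.Iso.symm h

theorem trans (h : Iso m d d') (h' : Iso m d' d'') : Iso m d d'' := Word.Iso.trans h h'

theorem cons {x : ℕ × Blk P} (h : Iso (m - x.2.inp + x.2.out) d d') :
    Iso m (x :: d) (x :: d') := by
  refine Word.Iso.append_left _ ?_
  rwa [ht_word]

/-- Two blocks side by side may exchange their heights. -/
theorem swap {p q q' : ℕ} {g h : Blk P} (hq : p + g.out ≤ q) (hq' : q' + g.out = q + g.inp) :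
    Iso m ((p, g) :: (q, h) :: d) ((q', h) :: (p, g) :: d) := by
  obtain rfl : q' = q - g.out + g.inp := by omega
  unfold Iso
  simpa [word] using (swap_word m p q g h hq).append_right (word d)

theorem cups_add (p i j : ℕ) : Iso m ((p, C (i + j)) :: d) ((p, C i) :: (p + i, C j) :: d) :=
  of_word_eq (by simp [word, Blk.word, Word.cups_add])

theorem caps_add (p i j : ℕ) : Iso m ((p, K (i + j)) :: d) ((p + j, K i) :: (p, K j) :: d) :=
  of_word_eq (by simp [word, Blk.word, Word.caps_add])

theorem cap_cup_right_one {p : ℕ} (h : p + 1 ≤ m) :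
    Iso m ((p, C 1) :: (p + 1, K 1) :: d) d :=
  Word.Iso.append_right (Word.Iso.of_move (Word.Move.straighten_right p) fun s m' => by
    simp only [Word.Fits, Piece.inp, Piece.out, Piece.Allowed, true_and]; omega) (word d)

theorem cap_cup_left_one {p : ℕ} (h : p + 1 ≤ m) :
    Iso m ((p + 1, C 1) :: (p, K 1) :: d) d :=
  Word.Iso.append_right (Word.Iso.of_move (Word.Move.straighten_left p) fun s m' => by
    simp only [Word.Fits, Piece.inp, Piece.out, Piece.Allowed, true_and]; omega) (word d)

/-- Parallel strings with a minimum followed on their right by a maximum may be straightened. -/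
theorem straighten_right {p q j : ℕ} (hq : q = p + j) (h : p + j ≤ m) :
    Iso m ((p, C j) :: (q, K j) :: d) d := by
  subst hq
  induction j generalizing d with
  | zero => exact of_word_eq rfl
  | succ j ih =>
    -- The innermost minimum meets the outermost maximum. Both are split off; the remaining `j`
    -- maxima then lie to the right of the split minimum and can be lowered past it.
    refine (cups_add p j 1).trans ?_
    refine (cons (cons (caps_add (p + (j + 1)) j 1))).trans ?_
    refine (cons (swap (q' := p + j) ?_ ?_)).trans ?_
    · simp only [out]; omega
    · simp only [out, inp]; omega
    refine (ih (by omega)).trans ?_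
    exact cap_cup_right_one (by omega)

/-- Parallel strings with a minimum followed on their left by a maximum may be straightened. -/
theorem straighten_left {p q j : ℕ} (hq : q = p + j) (h : p + j ≤ m) :
    Iso m ((q, C j) :: (p, K j) :: d) d := by
  subst hq
  induction j generalizing d with
  | zero => exact of_word_eq rfl
  | succ j ih =>
    rw [add_comm j 1]
    refine (cups_add (p + (1 + j)) 1 j).trans ?_
    refine (cons (cons (caps_add p 1 j))).trans ?_
    refine (cons (Iso.symm (swap (p := p + j) (q := p + j) (h := C j) ?_ ?_))).trans ?_
    · simp only [out]; omega
    · simp only [out, inp]; omega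
    rw [show p + (1 + j) = p + j + 1 by ring]
    refine (cap_cup_left_one (by omega)).trans ?_
    exact ih (by omega)

/-- An input disc may be rotated by `2π`. -/
theorem rotate {p q j : ℕ} {t : Bool} {n : ℕ} {v : P t n} (hq : q = p + 2 * n) (hj : j = 2 * n) :
    Iso m ((p, C j) :: (q, B v) :: (p, K j) :: d) ((p, B v) :: d) := by
  subst hq hj
  have := Word.Iso.append_right (Word.Iso.of_move (m := m) (Word.Move.rotate p t n v) ?_) (word d)
  · unfold Iso
    simpa [word, Blk.word] using this
  · intro s m'
    have hc := regionColour_congr (s := s) (p := p + 2 * n) (q := p) (by omega)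
    have key : (Word.cups p (2 * n) ++ ⟨p + 2 * n, Piece.box t n v⟩ :: Word.caps p (2 * n) : Word P)
      = word [(p, C (2 * n)), (p + 2 * n, B v), (p, K (2 * n))] := by simp [word, Blk.word]
    constructor
    · intro h
      have e := h.ht_eq
      -- The first minimum of the bundle forces `p ≤ m`. For `n = 0` there is no minimum, and the
      -- bound comes from the disc itself.
      have hp : 0 < n → p ≤ m := by
        intro hn
        obtain ⟨i, hi⟩ : ∃ i, 2 * n = i + 1 := ⟨2 * n - 1, by omega⟩
        rw [hi] at h
        exact h.1
      rw [Word.fits_append_iff] at h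
      obtain ⟨h1, h2, h3, -⟩ := h
      simp only [Word.ht_append, Word.ht_cons, Word.ht_cups, Word.ht_caps, Piece.inp, Piece.out,
        Piece.Allowed] at *
      rw [hc] at h3
      exact ⟨by simp only [Piece.inp]; omega, h3, by
        simp only [Word.Fits, Piece.inp, Piece.out]; omega⟩
    · rintro ⟨h1, h2, h3⟩
      rw [key]
      simp only [Piece.inp, Piece.out, Piece.Allowed, Word.Fits] at h1 h2 h3
      refine fits_word ⟨h1, trivial, ?_, ?_, ?_, trivial, trivial⟩ ?_
      · simp only [inp, out]; omega
      · simp only [Blk.Allowed]; rw [hc]; exact h2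
      · simp only [inp, out]; omega
      · simp only [ht, inp, out]; omega

end Iso

end Diag

-- Region colours, and stacks inserted between other strings

attribute [simp] Diag.Ok Diag.ht Diag.shift Diag.reflect Blk.inp Blk.out Blk.map

@[simp] theorem regionColour_regionColour (s : Bool) (p q : ℕ) :
    regionColour (regionColour s p) q = regionColour s (p + q) := by
  simp only [regionColour, Nat.even_add]
  by_cases hp : Even p <;> by_cases hq : Even q <;> simp [hp, hq]

theorem regionColour_succ (s : Bool) (p : ℕ) : regionColour s (p + 1) = regionColour (!s) p := by
  rw [add_comm, ← regionColour_regionColour]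
  rfl

@[simp] theorem Diag.shift_zero {P : Bool → ℕ → Type u} (d : Diag P) : d.shift 0 = d := by
  induction d with
  | nil => rfl
  | cons x d ih => simp [Diag.shift, ih]

@[simp] theorem Blk.allowed_C {P : Bool → ℕ → Type u} (c : Bool) (j : ℕ) :
    (Blk.C j : Blk P).Allowed c := trivial

@[simp] theorem Blk.allowed_K {P : Bool → ℕ → Type u} (c : Bool) (j : ℕ) :
    (Blk.K j : Blk P).Allowed c := trivial

@[simp] theorem Blk.allowed_B {P : Bool → ℕ → Type u} (s : Bool) (p : ℕ) {n : ℕ} (v : P s n) :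
    (Blk.B v : Blk P).Allowed (regionColour s p) ↔ p % 2 = 0 := by
  rw [← Nat.even_iff]
  by_cases hp : Even p <;> simp [Blk.Allowed, regionColour, hp]

@[simp] theorem Blk.allowed_B_not {P : Bool → ℕ → Type u} (s : Bool) (p : ℕ) {n : ℕ}
    (v : P s n) : (Blk.B v : Blk P).Allowed (regionColour (!s) p) ↔ p % 2 = 1 := by
  rw [← Nat.odd_iff, ← Nat.not_even_iff_odd]
  by_cases hp : Even p <;> simp [Blk.Allowed, regionColour, hp]

theorem Word.Fits.shift {P : Bool → ℕ → Type u} {s : Bool} {p m m' : ℕ} {w : Word P}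
    (h : Word.Fits (regionColour s p) w m m') : Word.Fits s (Word.shift p w) (p + m) (p + m') := by
  induction w generalizing m with
  | nil => exact congrArg _ h
  | cons l w ih =>
    obtain ⟨h1, h2, h3⟩ := h
    refine ⟨by dsimp only; omega, by rwa [regionColour_regionColour] at h2, ?_⟩
    have := ih h3
    rwa [show p + (m - l.piece.inp + l.piece.out) = p + m - l.piece.inp + l.piece.out by omega]
      at this

theorem Word.Fits.add_right {P : Bool → ℕ → Type u} {s : Bool} {m m' : ℕ} {w : Word P}
    (h : Word.Fits s w m m') (r : ℕ) : Word.Fits s w (m + r) (m' + r) := by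
  induction w generalizing m with
  | nil => exact congrArg (· + r) h
  | cons l w ih =>
    obtain ⟨h1, h2, h3⟩ := h
    refine ⟨by omega, h2, ?_⟩
    have := ih h3
    rwa [show m - l.piece.inp + l.piece.out + r = m + r - l.piece.inp + l.piece.out by omega]
      at this

/-! ### Evaluation of diagrams in a planar algebra -/

namespace PlanarAlgebra

variable (A : PlanarAlgebra.{u})

open Blk Diag

open scoped Classical in
/-- The value of a diagram, with the convention that a diagram that does not fit has value `0`. -/
noncomputable def ev (s : Bool) (n : ℕ) (d : Diag A.P) : A.P s n :=
  if h : Word.Fits s (Diag.word d) 0 (2 * n) then A.Z ⟨Diag.word d, h⟩ else 0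

variable {A} {s : Bool} {n : ℕ}

theorem Z_eq_ev (T : Tangle A.P s n) (d : Diag A.P) (h : Diag.word d = T.1) : A.Z T = A.ev s n d := by
  obtain ⟨w, hw⟩ := T
  subst h
  simp [ev, hw]

/-- `Step` demands that the two sides of a move fit alike, so the default value `0` is taken on both
sides or on neither. A bare `Word.Move` would not suffice: a minimum at the far right followed by a
maximum reaching beyond the strings does not fit, while its straightening does. -/
theorem ev_iso {d e : Diag A.P} (h : Diag.Iso 0 d e) : A.ev s n d = A.ev s n e := by
  unfold Diag.Iso at h
  unfold ev
  generalize Diag.word d = w at h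
  generalize Diag.word e = w' at h
  induction h with
  | rel w w' h =>
    obtain ⟨u, x, y, v, hm, hf, rfl, rfl⟩ := h
    have key : Word.Fits s (u ++ x ++ v) 0 (2 * n) ↔ Word.Fits s (u ++ y ++ v) 0 (2 * n) := by
      simp only [List.append_assoc, Word.fits_append_iff]
      refine and_congr_right fun _ => ?_
      constructor
      · rintro ⟨h1, h2⟩
        have h1' := (hf _ _).1 h1
        rw [h1'.ht_eq]
        exact ⟨h1', h2⟩
      · rintro ⟨h1, h2⟩
        have h1' := (hf _ _).2 h1
        rw [h1'.ht_eq]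
        exact ⟨h1', h2⟩
    by_cases h : Word.Fits s (u ++ x ++ v) 0 (2 * n)
    · have h' := key.1 h
      simp only [h, h', dif_pos]
      exact A.Z_isotopy _ _ (Relation.EqvGen.rel _ _ ⟨u, x, y, v, hm, rfl, rfl⟩)
    · have h' := mt key.2 h
      simp only [h, h']
      rfl
  | refl => rfl
  | symm _ _ _ ih => exact ih.symm
  | trans _ _ _ _ _ ih ih' => exact ih.trans ih'

theorem ev_single (v : A.P s n) : A.ev s n [(0, B v)] = v :=
  (Z_eq_ev (Tangle.single v) [(0, B v)] rfl).symm.trans (A.Z_single v)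

theorem word_box (d e : Diag A.P) (p : ℕ) {t : Bool} {l : ℕ} (v : A.P t l) :
    Diag.word (d ++ (p, B v) :: e) = Diag.word d ++ ⟨p, Piece.box t l v⟩ :: Diag.word e := by
  simp [Diag.word, Blk.word]

theorem fits_label {d e : Diag A.P} {p : ℕ} {t : Bool} {l m m' : ℕ} {v : A.P t l} (v' : A.P t l)
    (h : Word.Fits s (Diag.word (d ++ (p, B v) :: e)) m m') :
    Word.Fits s (Diag.word (d ++ (p, B v') :: e)) m m' := by
  rw [word_box, Word.fits_append_iff] at *
  exact h

/-- Fitting does not depend on labels, so with the default value `0` additivity needs no hypothesis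
on the diagram. -/
theorem ev_add (d e : Diag A.P) (p : ℕ) {t : Bool} {l : ℕ} (x y : A.P t l) :
    A.ev s n (d ++ (p, B (x + y)) :: e) =
      A.ev s n (d ++ (p, B x) :: e) + A.ev s n (d ++ (p, B y) :: e) := by
  by_cases h : Word.Fits s (Diag.word (d ++ (p, B x) :: e)) 0 (2 * n)
  · have h1 := fits_label y h
    have h2 := fits_label (x + y) h
    rw [ev, ev, ev, dif_pos h, dif_pos h1, dif_pos h2]
    simp only [word_box] at *
    exact A.Z_add _ _ _ _ _ _ _ _ _ _
  · have h1 : ¬ _ := fun h' => h (fits_label (v := y) x h')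
    have h2 : ¬ _ := fun h' => h (fits_label (v := x + y) x h')
    rw [ev, ev, ev, dif_neg h, dif_neg h1, dif_neg h2, add_zero]

theorem ev_smul (d e : Diag A.P) (p : ℕ) {t : Bool} {l : ℕ} (c : ℂ) (x : A.P t l) :
    A.ev s n (d ++ (p, B (c • x)) :: e) = c • A.ev s n (d ++ (p, B x) :: e) := by
  by_cases h : Word.Fits s (Diag.word (d ++ (p, B x) :: e)) 0 (2 * n)
  · have h2 := fits_label (c • x) h
    rw [ev, ev, dif_pos h, dif_pos h2]
    simp only [word_box] at *
    exact A.Z_smul _ _ _ _ _ _ _ _ _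
  · have h2 : ¬ _ := fun h' => h (fits_label (v := c • x) x h')
    rw [ev, ev, dif_neg h, dif_neg h2, smul_zero]

theorem ev_zero (d e : Diag A.P) (p : ℕ) {t : Bool} {l : ℕ} :
    A.ev s n (d ++ (p, B (0 : A.P t l)) :: e) = 0 := by
  simpa using ev_smul (s := s) (n := n) d e p 0 (0 : A.P t l)

/-- A diagram may be glued into an input disc. -/
theorem ev_glue (d e : Diag A.P) (p : ℕ) {t : Bool} {l : ℕ} (U : Diag A.P)
    (hU : Ok t U 0) (hl : Diag.ht U 0 = 2 * l)
    (h : Ok s (d ++ (p, B (A.ev t l U)) :: e) 0)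
    (hn : Diag.ht (d ++ (p, B (A.ev t l U)) :: e) 0 = 2 * n) :
    A.ev s n (d ++ (p, B (A.ev t l U)) :: e) = A.ev s n (d ++ (U.shift p ++ e)) := by
  have hU := Diag.fits_word hU hl
  have h := Diag.fits_word h hn
  have h' : Word.Fits s (Diag.word d ++ (Word.shift p (Diag.word U) ++ Diag.word e)) 0 (2 * n) := by
    rw [word_box, Word.fits_append_iff] at h
    obtain ⟨h1, h2, h3, h4⟩ := h
    refine Word.fits_append h1 (Word.fits_append ?_ h4)
    simp only [Piece.Allowed] at h3
    subst h3
    simp only [Piece.inp, add_zero] at h2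
    have := hU.shift.add_right (Word.ht (Diag.word d) 0 - p)
    rw [add_zero, Nat.add_sub_cancel' h2] at this
    convert this using 1
    simp only [Piece.inp, Piece.out]
    omega
  have hZ : A.ev t l U = A.Z ⟨Diag.word U, hU⟩ := by rw [ev, dif_pos hU]
  rw [hZ] at h ⊢
  rw [← Z_eq_ev ⟨_, h'⟩ (d ++ (U.shift p ++ e)) (by simp [word_shift]), ev, dif_pos h]
  simp only [word_box] at *
  exact A.Z_glue _ _ _ _ _ ⟨Diag.word U, hU⟩ _ h'

theorem ev_glue_zero (e : Diag A.P) {t : Bool} {l : ℕ} (U : Diag A.P)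
    (hU : Ok t U 0) (hl : Diag.ht U 0 = 2 * l)
    (h : Ok s ((0, B (A.ev t l U)) :: e) 0)
    (hn : Diag.ht ((0, B (A.ev t l U)) :: e) 0 = 2 * n) :
    A.ev s n ((0, B (A.ev t l U)) :: e) = A.ev s n (U ++ e) := by
  simpa using ev_glue [] e 0 U hU hl h hn

end PlanarAlgebra

/-! ### Reflection, and sphericity for several strings -/

namespace PlanarStarAlgebra

open Blk Diag PlanarAlgebra

variable {A : PlanarStarAlgebra.{u}}

theorem adj_ev {s : Bool} {n : ℕ} (d : Diag A.P) (h : Ok s d 0) (hn : Diag.ht d 0 = 2 * n) :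
    A.adj (A.ev s n d) = A.ev s n (Diag.reflect A.adj 0 d) := by
  have hf := Diag.fits_word h hn
  rw [ev, dif_pos hf]
  refine (A.adj_Z ⟨_, hf⟩).trans ?_
  exact Z_eq_ev _ _ (Diag.word_reflect A.adj h)

variable (A) in
/-- The value of a diagram without marked points, as a scalar. -/
noncomputable def sc (s : Bool) (d : Diag A.P) : ℂ := A.scalar (A.ev s 0 d)

theorem sc_iso {s : Bool} {d e : Diag A.P} (h : Diag.Iso 0 d e) : A.sc s d = A.sc s e :=
  congrArg A.scalar (ev_iso h)

theorem sc_glue {s : Bool} (d e : Diag A.P) (p : ℕ) {t : Bool} {l : ℕ} (U : Diag A.P)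
    (hU : Ok t U 0) (hl : Diag.ht U 0 = 2 * l)
    (h : Ok s (d ++ (p, B (A.ev t l U)) :: e) 0)
    (hn : Diag.ht (d ++ (p, B (A.ev t l U)) :: e) 0 = 0) :
    A.sc s (d ++ (p, B (A.ev t l U)) :: e) = A.sc s (d ++ (U.shift p ++ e)) :=
  congrArg A.scalar (ev_glue d e p U hU hl h hn)

theorem sc_glue_zero {s : Bool} (e : Diag A.P) {t : Bool} {l : ℕ} (U : Diag A.P)
    (hU : Ok t U 0) (hl : Diag.ht U 0 = 2 * l)
    (h : Ok s ((0, B (A.ev t l U)) :: e) 0)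
    (hn : Diag.ht ((0, B (A.ev t l U)) :: e) 0 = 0) :
    A.sc s ((0, B (A.ev t l U)) :: e) = A.sc s (U ++ e) := by
  simpa using sc_glue [] e 0 U hU hl h hn

theorem scalar_closeRight {s : Bool} (x : A.P s 1) :
    A.scalar (A.Z (Tangle.closeRight x)) = A.sc s [(0, B x), (0, K 1)] :=
  congrArg A.scalar (Z_eq_ev _ _ rfl)

theorem scalar_closeLeft {s : Bool} (x : A.P s 1) :
    A.scalar (A.Z (Tangle.closeLeft x)) =
      A.sc (!s) [(0, C 1), (1, B x), (0, K 1), (0, K 1)] :=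
  congrArg A.scalar (Z_eq_ev _ _ rfl)

/-- Closing all strings of a disc on its right or on its left gives the same scalar. -/
theorem sc_close (hA : A.IsSubfactor) (N : ℕ) : ∀ (s : Bool) (y : A.P s N),
    A.sc s [(0, B y), (0, K N)] =
      A.sc (regionColour s N) [(0, C N), (N, B y), (0, K N), (0, K N)] := by
  induction N with
  | zero => exact fun s y => sc_iso (Diag.Iso.of_word_eq rfl)
  | succ N ih =>
    intro s y
    -- The inner `N` strings are closed first. What remains has two marked points, so the one-string
    -- spherical axiom moves the outermost string to the left.
    have h1 : A.sc s [(0, B y), (0, K (N + 1))] =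
        A.sc s [(0, B (A.ev s 1 [(0, B y), (1, K N)])), (0, K 1)] := by
      refine Eq.trans ?_ (sc_glue_zero [(0, K 1)] [(0, B y), (1, K N)] ?_ ?_ ?_ ?_).symm
      · exact sc_iso (Iso.cons (Iso.caps_add 0 N 1))
      all_goals simp <;> omega
    have h2 : A.sc (!s) [(0, C 1), (1, B (A.ev s 1 [(0, B y), (1, K N)])), (0, K 1), (0, K 1)] =
        A.sc (!s) [(0, C 1), (1, B y), (2, K N), (0, K 1), (0, K 1)] := by
      refine sc_glue [(0, C 1)] [(0, K 1), (0, K 1)] 1 [(0, B y), (1, K N)] ?_ ?_ ?_ ?_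
      all_goals simp <;> omega
    have h3 : A.sc (!s) [(0, C 1), (1, B y), (2, K N), (0, K 1), (0, K 1)] =
        A.sc (!s) [(0, C 1), (1, B y), (0, K 1), (2 * N, K 1), (0, K N)] := by
      refine sc_iso (Iso.cons (Iso.cons ?_))
      refine (Iso.symm (Iso.swap (q := 0) ?_ ?_)).trans (Iso.cons (Iso.swap ?_ ?_))
      all_goals simp <;> omega
    -- With the outermost string closed on the left, `y` becomes a disc with `2 * N` marked points
    -- whose distinguished interval has the opposite colour; the induction hypothesis applies to it.
    have h4 : A.sc (!s) [(0, B (A.ev (!s) N [(0, C 1), (1, B y), (0, K 1), (2 * N, K 1)])),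
          (0, K N)] =
        A.sc (!s) [(0, C 1), (1, B y), (0, K 1), (2 * N, K 1), (0, K N)] := by
      refine sc_glue_zero [(0, K N)] [(0, C 1), (1, B y), (0, K 1), (2 * N, K 1)] ?_ ?_ ?_ ?_
      all_goals simp <;> omega
    have h5 : A.sc (regionColour (!s) N) [(0, C N),
          (N, B (A.ev (!s) N [(0, C 1), (1, B y), (0, K 1), (2 * N, K 1)])), (0, K N), (0, K N)] =
        A.sc (regionColour (!s) N) [(0, C N), (N, C 1), (N + 1, B y), (N, K 1),
          (N + 2 * N, K 1), (0, K N), (0, K N)] := by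
      refine sc_glue [(0, C N)] [(0, K N), (0, K N)] N
        [(0, C 1), (1, B y), (0, K 1), (2 * N, K 1)] ?_ ?_ ?_ ?_
      all_goals simp <;> omega
    rw [h1, ← scalar_closeRight, hA.spherical, scalar_closeLeft, h2, h3, ← h4, ih, h5,
      regionColour_succ]
    refine sc_iso (Iso.symm ?_)
    refine (Iso.cups_add 0 N 1).trans ?_
    rw [zero_add]
    refine Iso.cons (Iso.cons (Iso.cons ?_))
    refine (Iso.of_eq (d' := [(0, K (1 + N)), (0, K (1 + N))]) (by rw [add_comm])).trans ?_
    refine (Iso.caps_add 0 1 N).trans ?_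
    refine (Iso.cons (Iso.cons (Iso.caps_add 0 1 N))).trans ?_
    rw [zero_add]
    refine Iso.cons (Iso.swap ?_ ?_)
    all_goals simp <;> omega

end PlanarStarAlgebra

/-! ### Moves in the form used for long diagram computations -/

namespace Diag.Iso

open Blk

variable {P : Bool → ℕ → Type u} {m : ℕ} {d d' : Diag P}

/-- `swap` with its new position explicit: the block on the right goes down. -/
theorem lower (q' : ℕ) {p q : ℕ} {g h : Blk P}
    (hq : p + g.out ≤ q := by simp only [Blk.inp, Blk.out] <;> omega)
    (hq' : q' + g.out = q + g.inp := by simp only [Blk.inp, Blk.out] <;> omega) :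
    Iso m ((p, g) :: (q, h) :: d) ((q', h) :: (p, g) :: d) := swap hq hq'

/-- `swap` with its new position explicit: the block on the right goes up. -/
theorem raise (q : ℕ) {p q' : ℕ} {g h : Blk P}
    (hq : p + g.out ≤ q := by simp only [Blk.inp, Blk.out] <;> omega)
    (hq' : q' + g.out = q + g.inp := by simp only [Blk.inp, Blk.out] <;> omega) :
    Iso m ((q', h) :: (p, g) :: d) ((p, g) :: (q, h) :: d) := (swap hq hq').symm

theorem cons2 {x y : ℕ × Blk P}
    (h : Iso (m - x.2.inp + x.2.out - y.2.inp + y.2.out) d d') :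
    Iso m (x :: y :: d) (x :: y :: d') := cons (cons h)

theorem cons3 {x y z : ℕ × Blk P}
    (h : Iso (m - x.2.inp + x.2.out - y.2.inp + y.2.out - z.2.inp + z.2.out) d d') :
    Iso m (x :: y :: z :: d) (x :: y :: z :: d') := cons (cons2 h)

theorem cons4 {x y z w : ℕ × Blk P}
    (h : Iso (m - x.2.inp + x.2.out - y.2.inp + y.2.out - z.2.inp + z.2.out
      - w.2.inp + w.2.out) d d') :
    Iso m (x :: y :: z :: w :: d) (x :: y :: z :: w :: d') := cons (cons3 h)

theorem cons5 {x y z w v : ℕ × Blk P}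
    (h : Iso (m - x.2.inp + x.2.out - y.2.inp + y.2.out - z.2.inp + z.2.out
      - w.2.inp + w.2.out - v.2.inp + v.2.out) d d') :
    Iso m (x :: y :: z :: w :: v :: d) (x :: y :: z :: w :: v :: d') := cons (cons4 h)

theorem cups_split (i j : ℕ) {p l : ℕ} (h : l = i + j := by omega) :
    Iso m ((p, C l) :: d) ((p, C i) :: (p + i, C j) :: d) := by
  subst h; exact cups_add p i j

theorem caps_split (i j : ℕ) {p l : ℕ} (h : l = i + j := by omega) :
    Iso m ((p, K l) :: d) ((p + j, K i) :: (p, K j) :: d) := by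
  subst h; exact caps_add p i j

theorem caps_zero {p : ℕ} : Iso m ((p, K 0) :: d) d := of_word_eq rfl

end Diag.Iso

/-! ### Scalars, the form, and associativity term by term -/

namespace PlanarStarAlgebra

open Blk Diag PlanarAlgebra

variable {A : PlanarStarAlgebra.{u}}

theorem Z_empty_eq_ev (s : Bool) : A.Z (Tangle.empty s) = A.ev s 0 [] := Z_eq_ev _ _ rfl

/-- A disc labelled by the empty diagram can be placed next to any `x` without changing it. If that
label were zero, multilinearity would make every `x` zero, against dimension one. -/
theorem Z_empty_ne_zero (hA : A.IsSubfactor) (s : Bool) : A.Z (Tangle.empty s) ≠ 0 := by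
  intro h0
  have h : ∀ x : A.P s 0, x = 0 := by
    intro x
    have h1 : A.ev s 0 [(0, B (A.ev s 0 [])), (0, B x)] = A.ev s 0 [(0, B x)] :=
      ev_glue_zero [(0, B x)] [] (by simp) (by simp) (by simp) (by simp)
    rw [← Z_empty_eq_ev, h0, ev_single] at h1
    rw [← h1]
    exact ev_zero [] _ 0
  have := hA.finrank_zero s
  have hs : Subsingleton (A.P s 0) := ⟨fun x y => by rw [h x, h y]⟩
  rw [Module.finrank_zero_of_subsingleton] at this
  exact zero_ne_one this

theorem scalar_smul_empty (hA : A.IsSubfactor) {s : Bool} (c : ℂ) :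
    A.scalar (c • A.Z (Tangle.empty s)) = c := by
  have h : ∃ c' : ℂ, c • A.Z (Tangle.empty s) = c' • A.Z (Tangle.empty s) := ⟨c, rfl⟩
  rw [scalar, dif_pos h]
  exact (smul_left_injective ℂ (Z_empty_ne_zero hA s) h.choose_spec).symm

theorem exists_eq_smul_empty (hA : A.IsSubfactor) {s : Bool} (x : A.P s 0) :
    ∃ c : ℂ, x = c • A.Z (Tangle.empty s) := by
  obtain ⟨c, hc⟩ := (finrank_eq_one_iff_of_nonzero' _ (Z_empty_ne_zero hA s)).1
    (hA.finrank_zero s) x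
  exact ⟨c, hc.symm⟩

theorem scalar_add (hA : A.IsSubfactor) {s : Bool} (x y : A.P s 0) :
    A.scalar (x + y) = A.scalar x + A.scalar y := by
  obtain ⟨c, rfl⟩ := exists_eq_smul_empty hA x
  obtain ⟨d, rfl⟩ := exists_eq_smul_empty hA y
  rw [← add_smul]
  simp only [scalar_smul_empty hA]

theorem scalar_smul (hA : A.IsSubfactor) {s : Bool} (a : ℂ) (x : A.P s 0) :
    A.scalar (a • x) = a * A.scalar x := by
  obtain ⟨c, rfl⟩ := exists_eq_smul_empty hA x
  rw [← mul_smul]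
  simp only [scalar_smul_empty hA]

theorem scalar_adj (hA : A.IsSubfactor) {s : Bool} (x : A.P s 0) :
    A.scalar (A.adj x) = starRingEnd ℂ (A.scalar x) := by
  obtain ⟨c, rfl⟩ := exists_eq_smul_empty hA x
  have h : A.adj (A.Z (Tangle.empty s)) = A.Z (Tangle.empty s) := by
    rw [Z_empty_eq_ev]
    exact adj_ev [] (by simp) (by simp)
  rw [A.adj_smul, h]
  simp only [scalar_smul_empty hA]

theorem form_eq_sc {s : Bool} {n : ℕ} (x y : A.P s n) :
    A.form x y = A.sc s [(0, B x), (2 * n, B (A.adj y)), (0, K (2 * n))] :=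
  congrArg A.scalar (Z_eq_ev _ _ (by simp [Diag.word, Blk.word, Tangle.pairing]))

theorem form_add_left (hA : A.IsSubfactor) {s : Bool} {n : ℕ} (x y z : A.P s n) :
    A.form (x + y) z = A.form x z + A.form y z := by
  simp only [form_eq_sc, sc]
  rw [← scalar_add hA]
  exact congrArg _ (ev_add [] _ 0 x y)

theorem form_smul_left (hA : A.IsSubfactor) {s : Bool} {n : ℕ} (c : ℂ) (x z : A.P s n) :
    A.form (c • x) z = c * A.form x z := by
  simp only [form_eq_sc, sc]
  rw [← scalar_smul hA]
  exact congrArg _ (ev_smul [] _ 0 c x)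

theorem form_conj (hA : A.IsSubfactor) {s : Bool} {n : ℕ} (x y : A.P s n) :
    starRingEnd ℂ (A.form x y) = A.form y x := by
  simp only [form_eq_sc, sc]
  rw [← scalar_adj hA, adj_ev _ (by simp <;> omega) (by simp <;> omega)]
  refine congrArg _ (ev_iso ?_)
  -- Reflection exchanges the two discs of the pairing; only their heights have to be restored.
  refine Iso.trans (Iso.of_eq ?_) (Iso.raise (p := 0) (q' := 0) (2 * n))
  simp [A.adj_adj]
  omega

/-- The degrees for which the product of `Gr k` has a term. -/
def Tri (m n N : ℕ) : Prop := N ≤ m + n ∧ m ≤ N + n ∧ n ≤ N + m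

instance (m n N : ℕ) : Decidable (Tri m n N) := by unfold Tri; infer_instance

/-- The diagram of the term with `i` joined top strings of the product of `Gr k`. -/
def prodDiag (k m n i : ℕ) {M M' : ℕ} (a : A.P true M) (b : A.P true M') : Diag A.P :=
  [(0, B a), (2 * m, B b), (2 * m - i, K i), ((2 * m - i) + (2 * n - i) + k, K k)]

variable (A) in
/-- The component in degree `N` of the product of elements of degrees `m` and `n`. -/
noncomputable def term (k m n N : ℕ) :
    A.P true (m + k) →ₗ[ℂ] A.P true (n + k) →ₗ[ℂ] A.P true (N + k) :=
  if Tri m n N then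
    LinearMap.mk₂ ℂ (fun a b => A.ev true (N + k) (prodDiag k m n (m + n - N) a b))
      (fun _ _ _ => ev_add [] _ 0 _ _)
      (fun _ _ _ => ev_smul [] _ 0 _ _)
      (fun a _ _ => ev_add [(0, B a)] _ _ _ _)
      (fun _ a _ => ev_smul [(0, B a)] _ _ _ _)
  else 0

variable {k m n N : ℕ}

theorem term_apply (i : ℕ) (hi : N + i = m + n) (hm : i ≤ 2 * m) (hn : i ≤ 2 * n)
    (a : A.P true (m + k)) (b : A.P true (n + k)) :
    A.term k m n N a b = A.ev true (N + k) (prodDiag k m n i a b) := by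
  obtain rfl : i = m + n - N := by omega
  rw [term, if_pos ⟨by omega, by omega, by omega⟩]
  rfl

theorem term_of_not_tri (h : ¬ Tri m n N) (a : A.P true (m + k)) (b : A.P true (n + k)) :
    A.term k m n N a b = 0 := by
  rw [term, if_neg h]
  rfl

theorem productTerm_eq_term (i : ℕ) (hm : i ≤ 2 * m) (hn : i ≤ 2 * n)
    (a : A.P true (m + k)) (b : A.P true (n + k)) :
    A.productTerm k m n i hm hn a b = A.term k m n (m + n - i) a b := by
  rw [term_apply i (by omega) hm hn]
  exact Z_eq_ev _ _ (by simp [prodDiag, Diag.word, Blk.word, Tangle.product])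

/-- Associativity, term by term: `p`, `q` and `r` top strings join the first factor to the
second, the second to the third and the first to the third. -/
theorem term_assoc {l u v p q r : ℕ} (hu : u + p = m + n) (hv : v + q = n + l)
    (hN : N + (q + r) = u + l) (hpq : p + q ≤ 2 * n) (hr : r = 0 ∨ p + q = 2 * n)
    (hqr : q + r ≤ 2 * l) (hpr : p + r ≤ 2 * m)
    (a : A.P true (m + k)) (b : A.P true (n + k)) (c : A.P true (l + k)) :
    A.term k u l N (A.term k m n u a b) c = A.term k m v N a (A.term k n l v b c) := by
  rw [term_apply p hu (by omega) (by omega), term_apply (q + r) hN (by omega) (by omega),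
    term_apply q hv (by omega) (by omega), term_apply (p + r) (by omega) (by omega) (by omega)]
  unfold prodDiag
  refine (ev_glue_zero _ [(0, B a), (2 * m, B b), (2 * m - p, K p),
    ((2 * m - p) + (2 * n - p) + k, K k)] ?_ ?_ ?_ ?_).trans ?_
  · simp; omega
  · simp; omega
  · simp; omega
  · simp; omega
  refine Eq.trans ?_ (ev_glue [(0, B a)] _ (2 * m) [(0, B b), (2 * n, B c), (2 * n - q, K q),
    ((2 * n - q) + (2 * l - q) + k, K k)] ?_ ?_ ?_ ?_).symm
  rotate_left
  · simp; omega
  · simp; omega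
  · simp; omega
  · simp; omega
  refine ev_iso ?_
  simp only [List.cons_append, List.nil_append, Diag.shift, add_zero]
  refine Iso.cons2 ?_
  -- the third disc goes down
  refine (Iso.cons (Iso.raise (2 * u + k + 2 * (l + k)))).trans ?_
  refine (Iso.lower (2 * m + 2 * n)).trans ?_
  refine Iso.cons ?_
  -- the strings are put into the same order
  refine (Iso.cons2 (Iso.caps_split q r)).trans ?_
  refine (Iso.cons (Iso.raise (2 * u + k + 2 * (l + k) - 2 * q))).trans ?_
  refine (Iso.cons2 (Iso.raise (2 * u + k + 2 * (l + k) - 2 * q - 2 * r))).trans ?_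
  refine (Iso.cons3 (Iso.raise (2 * u + k + 2 * (l + k) - 2 * q - 2 * r - 2 * k))).trans ?_
  refine (Iso.cons2 (Iso.lower (2 * u - (q + r) + (2 * l - (q + r)) + k + 2 * r))).trans ?_
  refine (Iso.lower (2 * m + 2 * n - q)).trans ?_
  refine (Iso.cons (Iso.lower (2 * m + 2 * n + 2 * l - 2 * q + k))).trans ?_
  refine Iso.trans ?_ (Iso.cons2 (Iso.caps_split p r).symm)
  -- Planarity enters here. Strings from the first to the third factor exist only if the second has
  -- no free top string left. If `r = 0` the bundle is empty and its position is immaterial;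
  -- otherwise `p + q = 2 * n` makes the two positions agree.
  rcases hr with rfl | hr
  · refine (Iso.cons3 Iso.caps_zero).trans (Iso.trans ?_ (Iso.cons3 Iso.caps_zero).symm)
    refine Iso.of_eq ?_
    simp
    omega
  · refine Iso.of_eq ?_
    simp
    omega

end PlanarStarAlgebra

/-! ### Unit, involution and adjointness as isotopies -/

namespace PlanarStarAlgebra

open Blk Diag PlanarAlgebra

variable {A : PlanarStarAlgebra.{u}}

variable (A) in
/-- The unit of `Gr k`: `k` parallel strings. -/
noncomputable def one (k : ℕ) : A.P true (0 + k) := A.ev true (0 + k) [(0, C k)]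

variable {k m n N : ℕ}

theorem one_term (b : A.P true (n + k)) : A.term k 0 n n (A.one k) b = b := by
  rw [term_apply 0 (by omega) (by omega) (by omega)]
  unfold prodDiag one
  refine (ev_glue_zero _ [(0, C k)] ?_ ?_ ?_ ?_).trans ?_
  any_goals simp <;> omega
  refine Eq.trans (ev_iso ?_) (ev_single b)
  refine (Iso.cons2 Iso.caps_zero).trans ?_
  refine (Iso.raise (2 * (n + k))).trans (Iso.cons (Iso.straighten_left ?_ ?_))
  all_goals simp <;> omega

theorem term_one (a : A.P true (n + k)) : A.term k n 0 n a (A.one k) = a := by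
  rw [term_apply 0 (by omega) (by omega) (by omega)]
  unfold prodDiag one
  refine (ev_glue [(0, B a)] _ _ [(0, C k)] ?_ ?_ ?_ ?_).trans ?_
  any_goals simp <;> omega
  refine Eq.trans (ev_iso ?_) (ev_single a)
  refine (Iso.cons2 Iso.caps_zero).trans (Iso.cons (Iso.straighten_right ?_ ?_))
  all_goals simp <;> omega

theorem homStar_eq_ev (x : A.P true (n + k)) :
    A.homStar k n x = A.ev true (n + k)
      [(0, C (2 * n)), (2 * n, B (A.adj x)), (2 * n + 2 * k, K (2 * n))] :=
  Z_eq_ev _ _ (by simp [Diag.word, Blk.word, Tangle.rotation])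

/-- The two adjoints on the label cancel. In a pairing against `homStar x` the disc is therefore
labelled by `x` itself, up to rotation. -/
theorem adj_homStar (x : A.P true (n + k)) :
    A.adj (A.homStar k n x) = A.ev true (n + k)
      [(0, C (2 * n)), (2 * n, B x), (0, K (2 * n))] := by
  rw [homStar_eq_ev, adj_ev]
  · congr 1
    simp [A.adj_adj]
    omega
  all_goals simp <;> omega

theorem form_zero_left (hA : A.IsSubfactor) {s : Bool} (y : A.P s n) : A.form 0 y = 0 := by
  simpa using form_smul_left hA 0 0 y

theorem form_zero_right (hA : A.IsSubfactor) {s : Bool} (x : A.P s n) : A.form x 0 = 0 := by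
  rw [← form_conj hA, form_zero_left hA, map_zero]

/-- Multiplication by `a` is adjoint to multiplication by the star of `a`, term by term. -/
theorem form_term (hA : A.IsSubfactor) (a : A.P true (m + k)) (x : A.P true (n + k))
    (y : A.P true (N + k)) :
    A.form (A.term k m n N a x) y = A.form x (A.term k m N n (A.homStar k m a) y) := by
  by_cases h : Tri m n N
  swap
  -- `Tri` is symmetric in its three arguments, so the two terms vanish together.
  · have h' : ¬ Tri m N n := fun h' => h ⟨by have := h'.2.2; omega, by have := h'.2.1; omega,
      by have := h'.1; omega⟩
    rw [term_of_not_tri h, term_of_not_tri h', form_zero_left hA, form_zero_right hA]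
  obtain ⟨h1, h2, h3⟩ := h
  obtain ⟨i, hi⟩ := Nat.exists_eq_add_of_le h1
  obtain ⟨j, hj⟩ : ∃ j, j + i = 2 * m := ⟨2 * m - i, by omega⟩
  obtain ⟨M, hM⟩ : ∃ M, M + i = 2 * n := ⟨2 * n - i, by omega⟩
  rw [term_apply i (by omega) (by omega) (by omega), term_apply j (by omega) (by omega) (by omega)]
  unfold prodDiag
  rw [form_eq_sc, form_eq_sc, adj_ev]
  rotate_left
  · simp; omega
  · simp; omega
  simp only [Diag.reflect, Blk.map]
  rw [adj_homStar]
  -- `Y` joins everything common to both sides and leaves open the `2 * m` top strings of `a`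
  -- together with their partners, `i` at `x` and `j` at `y`. Closing `Y` on the right gives the
  -- left-hand side, and closing it on the left gives the right-hand side.
  let Y : A.P true (2 * m) := A.ev true (2 * m) [(0, B a), (2 * m, B x),
    (2 * m + 2 * n + k, K k), (2 * m + 2 * n + 2 * k, B (A.adj y)), (2 * m + i, K (M + (k + k)))]
  have hl : A.sc true [(0, B Y), (0, K (2 * m))] = A.sc true [(0, B a), (2 * m, B x),
      (j, K i), (j + M + k, K k), (2 * (N + k), B (A.adj y)), (0, K (2 * (N + k)))] := by
    refine (sc_glue_zero _ _ ?_ ?_ ?_ ?_).trans ?_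
    any_goals simp <;> omega
    refine sc_iso (Iso.symm ?_)
    refine Iso.cons2 ?_
    refine (Iso.lower (2 * m + 2 * n + k)).trans (Iso.cons ?_)
    refine (Iso.lower (2 * m + 2 * n + 2 * k)).trans (Iso.cons ?_)
    refine (Iso.cons (Iso.caps_split (M + (k + k)) j)).trans ?_
    refine (Iso.lower (2 * m + i)).trans (Iso.cons ?_)
    refine Iso.trans (Iso.of_eq ?_) (Iso.caps_split (m := _) i j).symm
    simp <;> omega
  have hr : A.sc true [(0, C (2 * m)), (2 * m, B Y), (0, K (2 * m)), (0, K (2 * m))] =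
      A.sc true [(0, B x), (2 * n + 2 * k, C (2 * m)), (2 * n + 2 * k + 2 * m, B a),
        (2 * n + 2 * k, K (2 * m)), (2 * n + k, K k), (2 * n + 2 * k, B (A.adj y)),
        (i, K (M + (k + k))), (0, K (2 * m))] := by
    refine (sc_glue [(0, C (2 * m))] _ _ _ ?_ ?_ ?_ ?_).trans ?_
    any_goals simp <;> omega
    refine sc_iso ?_
    refine (Iso.cons5 (Iso.raise i)).trans ?_
    refine (Iso.cons4 (Iso.raise (2 * n + 2 * k))).trans ?_
    refine (Iso.cons3 (Iso.raise (2 * n + k))).trans ?_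
    refine (Iso.cons2 (Iso.raise 0)).trans ?_
    refine (Iso.cons2 (Iso.raise (2 * n + 2 * k))).trans ?_
    refine (Iso.cons (Iso.raise (2 * n + 2 * k + 2 * m))).trans ?_
    exact Iso.raise (2 * n + 2 * k)
  have hc := sc_close hA (2 * m) true Y
  rw [show regionColour true (2 * m) = true by simp [regionColour], hl, hr] at hc
  refine Eq.trans (Eq.trans ?_ hc) (Eq.symm ?_)
  · refine (sc_glue_zero _ [(0, B a), (2 * m, B x), (2 * m - i, K i),
      ((2 * m - i) + (2 * n - i) + k, K k)] ?_ ?_ ?_ ?_).trans ?_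
    any_goals simp <;> omega
    exact sc_iso (Iso.of_eq (by simp; omega))
  refine (sc_glue [(0, B x)] _ _ _ ?_ ?_ ?_ ?_).trans ?_
  any_goals simp <;> omega
  simp only [Diag.shift, List.cons_append, List.nil_append]
  refine (sc_glue [(0, B x)] _ _ [(0, C (2 * m)), (2 * m, B a), (0, K (2 * m))]
    ?_ ?_ ?_ ?_).trans ?_
  any_goals simp <;> omega
  refine sc_iso ?_
  simp only [Diag.shift, List.cons_append, List.nil_append]
  refine (Iso.cons5 (Iso.cons2 (Iso.caps_split k (2 * n + k)))).trans ?_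
  refine (Iso.cons5 (Iso.cons3 (Iso.caps_split (M + k) i))).trans ?_
  refine (Iso.cons5 (Iso.raise (2 * n + 2 * N + 4 * k - j))).trans ?_
  refine (Iso.cons5 (Iso.cons (Iso.raise (2 * n + 2 * N + 2 * k - j)))).trans ?_
  refine (Iso.cons5 (Iso.cons2 (Iso.raise i))).trans (Iso.symm ?_)
  refine (Iso.cons4 (Iso.lower (2 * n + 4 * k))).trans ?_
  refine (Iso.cons5 (Iso.cons (Iso.caps_split k (M + k)))).trans ?_
  refine (Iso.cons5 (Iso.lower (2 * n + 3 * k))).trans ?_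
  refine (Iso.cons5 (Iso.cons3 (Iso.caps_split j i))).trans ?_
  refine Iso.of_eq ?_
  simp
  omega

/-- The other half of the trace property of the form, by a rotation of a disc. -/
theorem form_homStar (b a : A.P true (n + k)) :
    A.form b (A.homStar k n a) = A.form (A.term k n n 0 b a) (A.one k) := by
  have hone : A.adj (A.one k) = A.ev true (0 + k) [(0, C k)] := by
    unfold one
    rw [adj_ev]
    · rfl
    all_goals simp
  rw [form_eq_sc, form_eq_sc, adj_homStar, hone, term_apply (2 * n) (by omega) le_rfl le_rfl]
  unfold prodDiag
  refine (sc_glue [(0, B b)] _ _ _ ?_ ?_ ?_ ?_).trans ?_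
  any_goals simp <;> omega
  refine Eq.trans ?_ (sc_glue_zero _ [(0, B b), (2 * n, B a), (2 * n - 2 * n, K (2 * n)),
      ((2 * n - 2 * n) + (2 * n - 2 * n) + k, K k)] ?_ ?_ ?_ ?_).symm
  any_goals simp <;> omega
  refine Eq.trans ?_ (sc_glue [(0, B b), (2 * n, B a), (2 * n - 2 * n, K (2 * n)),
      ((2 * n - 2 * n) + (2 * n - 2 * n) + k, K k)] _ _ [(0, C k)] ?_ ?_ ?_ ?_).symm
  any_goals simp <;> omega
  refine sc_iso ?_
  simp only [Diag.shift, List.cons_append, List.nil_append]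
  -- the unit disappears and the maxima at the right are collected
  refine Iso.symm ?_
  refine (Iso.cons5 (Iso.caps_split k k)).trans ?_
  refine (Iso.cons4 (Iso.straighten_left ?_ ?_)).trans ?_
  · simp; omega
  · simp; omega
  refine (Iso.of_eq (d' := [(0, B b), (2 * n, B a), (0, K (2 * n)), (0 + k, K k), (0, K k)])
    (by simp)).trans ?_
  refine (Iso.cons3 (Iso.caps_split (l := 2 * k) k k).symm).trans ?_
  -- the second disc is rotated
  refine (Iso.cons (Iso.rotate rfl rfl).symm).trans ?_
  refine (Iso.cons (Iso.cups_split (2 * k) (2 * n))).trans ?_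
  refine (Iso.cons4 (Iso.caps_split (2 * n) (2 * k))).trans ?_
  -- the strings from the first disc to the rotated disc are straightened
  refine (Iso.cons5 (Iso.cons (Iso.lower (4 * n)))).trans ?_
  refine (Iso.cons5 (Iso.lower (4 * n + 4 * k))).trans ?_
  refine (Iso.cons4 (Iso.lower (8 * n + 4 * k))).trans ?_
  refine (Iso.cons3 (Iso.lower (6 * n + 2 * k))).trans ?_
  refine (Iso.cons2 (Iso.lower (2 * n + 2 * k))).trans ?_
  refine (Iso.cons (Iso.straighten_right rfl ?_)).trans ?_
  · simp; omega
  refine Iso.trans (Iso.of_eq ?_) (Iso.cons4 (Iso.caps_split (2 * k) (2 * n)).symm)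
  simp
  omega

/-- As the squared length of a single minimum, `δ` is real, and positive when that minimum is
nonzero. -/
theorem delta_eq_form : A.delta = A.form (A.ev true 1 [(0, C 1)]) (A.ev true 1 [(0, C 1)]) := by
  have h : A.delta = A.sc true [(0, C 1), (0, K 1)] := congrArg A.scalar (Z_eq_ev _ _ rfl)
  rw [h, form_eq_sc, adj_ev]
  rotate_left
  · simp
  · simp
  refine Eq.trans ?_ (sc_glue_zero _ [(0, C 1)] ?_ ?_ ?_ ?_).symm
  any_goals simp
  refine Eq.trans ?_ (sc_glue [(0, C 1)] [(0, K 2)] 2 [(0, C 1)] ?_ ?_ ?_ ?_).symm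
  any_goals simp
  refine sc_iso (Iso.symm ?_)
  refine (Iso.cons2 (Iso.caps_split 1 1)).trans (Iso.cons (Iso.straighten_left ?_ ?_))
  all_goals simp

/-- A string of `x` can be bent into a zigzag containing a minimum, so a vanishing minimum kills
every disc that has strings. -/
theorem eq_zero_of_cup_eq_zero (h : A.ev true 1 [(0, C 1)] = 0) (x : A.P true (n + 1)) :
    x = 0 := by
  have h1 : A.ev true (n + 1) [(0, B x), (0, B (A.ev true 1 [(0, C 1)])), (1, K 1)] =
      A.ev true (n + 1) [(0, B x), (0, C 1), (1, K 1)] := by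
    refine ev_glue [(0, B x)] _ 0 [(0, C 1)] ?_ ?_ ?_ ?_
    all_goals simp <;> omega
  have h2 : A.ev true (n + 1) [(0, B x), (0, C 1), (1, K 1)] = x := by
    refine Eq.trans (ev_iso (Iso.cons (Iso.straighten_right rfl ?_))) (ev_single x)
    simp; omega
  rw [← h2, ← h1, h]
  exact ev_zero [(0, B x)] _ 0

end PlanarStarAlgebra

/-! ### The algebra `Gr k`: associativity and unit -/

namespace PlanarStarAlgebra

open Blk Diag PlanarAlgebra

variable {A : PlanarStarAlgebra.{u}} {k m n N : ℕ}

variable (A k) in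
/-- The inclusion of `P_{n,k}` into `Gr k`. -/
noncomputable def hom (n : ℕ) : A.P true (n + k) →ₗ[ℂ] A.Gr k :=
  DirectSum.lof ℂ ℕ (fun n => A.P true (n + k)) n

theorem hom_apply_self (x : A.P true (n + k)) : A.hom k n x n = x :=
  DirectSum.of_eq_same (β := fun n => A.P true (n + k)) n x

theorem hom_apply_ne (h : m ≠ n) (x : A.P true (n + k)) : A.hom k n x m = 0 :=
  DirectSum.of_eq_of_ne (β := fun n => A.P true (n + k)) n m x h

theorem gr_induction {p : A.Gr k → Prop} (h0 : p 0) (hom : ∀ n x, p (A.hom k n x))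
    (add : ∀ x y, p x → p y → p (x + y)) (x : A.Gr k) : p x :=
  DirectSum.induction_on x h0 hom add

open scoped Classical in
theorem sum_support_hom (x : A.Gr k) : ∑ n ∈ DFinsupp.support x, A.hom k n (x n) = x :=
  DirectSum.sum_support_of x

theorem grMul_hom (a : A.P true (m + k)) (b : A.P true (n + k)) :
    A.grMul k (A.hom k m a) (A.hom k n b) =
      ∑ i ∈ Finset.range (min (2 * m) (2 * n) + 1),
        A.hom k (m + n - i) (A.term k m n (m + n - i) a b) := by
  have h : A.grMul k (A.hom k m a) (A.hom k n b) = A.homMul k m n a b := by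
    simp [grMul, hom]
  rw [h, homMul, ← Fin.sum_univ_eq_sum_range
    (fun i => A.hom k (m + n - i) (A.term k m n (m + n - i) a b))]
  simp only [LinearMap.sum_apply, LinearMap.compr₂_apply, productTerm_eq_term]
  rfl

/-- The range of `i` no longer depends on `n`, so for inhomogeneous right factors the sums over `i`
and `n` can be exchanged. The extra terms violate `Tri`. -/
theorem grMul_hom_eq_sum_range (a : A.P true (m + k)) (b : A.P true (n + k)) :
    A.grMul k (A.hom k m a) (A.hom k n b) =
      ∑ i ∈ Finset.range (2 * m + 1), A.hom k (m + n - i) (A.term k m n (m + n - i) a b) := by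
  rw [grMul_hom]
  refine Finset.sum_subset (fun i => by simp only [Finset.mem_range]; omega) fun i h1 h2 => ?_
  rw [term_of_not_tri, map_zero]
  simp only [Finset.mem_range] at h1 h2
  unfold Tri
  omega

theorem grMul_hom_eq_sum_degree {R : ℕ} (hR : m + n < R) (a : A.P true (m + k))
    (b : A.P true (n + k)) :
    A.grMul k (A.hom k m a) (A.hom k n b) =
      ∑ u ∈ Finset.range R, A.hom k u (A.term k m n u a b) := by
  rw [grMul_hom]
  rw [← Finset.sum_image (s := Finset.range (min (2 * m) (2 * n) + 1)) (g := fun i => m + n - i)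
    (f := fun u => A.hom k u (A.term k m n u a b))]
  · refine Finset.sum_subset (fun u => ?_) fun u h1 h2 => ?_
    · simp only [Finset.mem_image, Finset.mem_range]
      rintro ⟨i, hi, rfl⟩
      omega
    · rw [term_of_not_tri, map_zero]
      rintro ⟨t1, t2, t3⟩
      refine h2 (Finset.mem_image.2 ⟨m + n - u, ?_, ?_⟩)
      · simp only [Finset.mem_range]; omega
      · omega
  · intro i hi j hj h
    simp only [Finset.coe_range, Set.mem_Iio] at hi hj h
    omega

/-- Altogether `t = m + n + l - N` top strings are joined. Since the outer factors meet only when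
the middle one is exhausted, `p + q = min t (2 * n)` and `r = t - min t (2 * n)`. Thus `p`
determines `q`, and the nonzero terms on the two sides match one to one. -/
theorem sum_term_assoc {l : ℕ} (a : A.P true (m + k)) (b : A.P true (n + k))
    (c : A.P true (l + k)) (hN : N ≤ m + n + l) :
    ∑ u ∈ Finset.range (m + n + 1), A.term k u l N (A.term k m n u a b) c =
      ∑ v ∈ Finset.range (n + l + 1), A.term k m v N a (A.term k n l v b c) := by
  rw [← Finset.sum_filter_of_ne (p := fun u => Tri m n u ∧ Tri u l N),
    ← Finset.sum_filter_of_ne (s := Finset.range (n + l + 1))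
      (p := fun v => Tri n l v ∧ Tri m v N)]
  · refine Finset.sum_nbij'
      (fun u => n + l - (min (m + n + l - N) (2 * n) - (m + n - u)))
      (fun v => m + n - (min (m + n + l - N) (2 * n) - (n + l - v))) ?_ ?_ ?_ ?_ ?_
    · intro u
      simp only [Finset.mem_filter, Finset.mem_range]
      unfold Tri
      omega
    · intro v
      simp only [Finset.mem_filter, Finset.mem_range]
      unfold Tri
      omega
    · intro u
      simp only [Finset.mem_filter, Finset.mem_range]
      unfold Tri
      omega
    · intro v
      simp only [Finset.mem_filter, Finset.mem_range]
      unfold Tri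
      omega
    · intro u
      simp only [Finset.mem_filter, Finset.mem_range]
      unfold Tri
      intro h
      refine term_assoc (p := m + n - u) (q := min (m + n + l - N) (2 * n) - (m + n - u))
        (r := m + n + l - N - min (m + n + l - N) (2 * n)) ?_ ?_ ?_ ?_ ?_ ?_ ?_ a b c
      all_goals omega
  · intro v _ h
    by_contra hc
    rcases not_and_or.1 hc with hc | hc
    · exact h (by rw [term_of_not_tri hc, map_zero])
    · exact h (term_of_not_tri hc _ _)
  · intro u _ h
    by_contra hc
    rcases not_and_or.1 hc with hc | hc
    · exact h (by rw [term_of_not_tri hc, map_zero, LinearMap.zero_apply])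
    · exact h (term_of_not_tri hc _ _)

theorem grMul_assoc (x y z : A.Gr k) :
    A.grMul k (A.grMul k x y) z = A.grMul k x (A.grMul k y z) := by
  induction x using gr_induction with
  | h0 => simp
  | add x x' hx hx' => simp only [map_add, LinearMap.add_apply, hx, hx']
  | hom m a =>
  induction y using gr_induction with
  | h0 => simp
  | add x x' hx hx' => simp only [map_add, LinearMap.add_apply, hx, hx']
  | hom n b =>
  induction z using gr_induction with
  | h0 => simp
  | add x x' hx hx' => simp only [map_add, hx, hx']
  | hom l c =>
  rw [grMul_hom_eq_sum_degree (Nat.lt_succ_self _), grMul_hom_eq_sum_degree (Nat.lt_succ_self _)]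
  simp only [map_sum, LinearMap.sum_apply]
  trans ∑ u ∈ Finset.range (m + n + 1), ∑ N ∈ Finset.range (m + n + l + 1),
    A.hom k N (A.term k u l N (A.term k m n u a b) c)
  · refine Finset.sum_congr rfl fun u hu => grMul_hom_eq_sum_degree ?_ _ _
    rw [Finset.mem_range] at hu
    omega
  trans ∑ v ∈ Finset.range (n + l + 1), ∑ N ∈ Finset.range (m + n + l + 1),
    A.hom k N (A.term k m v N a (A.term k n l v b c))
  · rw [Finset.sum_comm, Finset.sum_comm (s := Finset.range (n + l + 1))]
    refine Finset.sum_congr rfl fun N hN => ?_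
    rw [← map_sum, ← map_sum, sum_term_assoc]
    rw [Finset.mem_range] at hN
    omega
  · refine Finset.sum_congr rfl fun v hv => (grMul_hom_eq_sum_degree ?_ _ _).symm
    rw [Finset.mem_range] at hv
    omega

variable (A k) in
/-- The unit of `Gr k`. -/
noncomputable def grOne : A.Gr k := A.hom k 0 (A.one k)

theorem grOne_mul (x : A.Gr k) : A.grMul k (A.grOne k) x = x := by
  induction x using gr_induction with
  | h0 => simp
  | add x x' hx hx' => simp only [map_add, hx, hx']
  | hom n b =>
    rw [grOne, grMul_hom_eq_sum_range]
    simp only [mul_zero, zero_add, Finset.range_one, Finset.sum_singleton, Nat.sub_zero]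
    have h : ∀ N, N = n → A.hom k N (A.term k 0 n N (A.one k) b) = A.hom k n b := by
      rintro _ rfl
      rw [one_term]
    exact h _ (by omega)

theorem grMul_one (x : A.Gr k) : A.grMul k x (A.grOne k) = x := by
  induction x using gr_induction with
  | h0 => simp
  | add x x' hx hx' => simp only [map_add, LinearMap.add_apply, hx, hx']
  | hom n b =>
    rw [grOne, grMul_hom]
    simp only [mul_zero, Finset.range_one, Finset.sum_singleton, Nat.sub_zero,
      min_eq_right (Nat.zero_le _), zero_add]
    exact congrArg _ (term_one b)

/-! ### Involution and inner product on `Gr k` -/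

theorem homStar_add (x y : A.P true (n + k)) :
    A.homStar k n (x + y) = A.homStar k n x + A.homStar k n y := by
  simp only [homStar_eq_ev, A.adj_add]
  exact ev_add [(0, C (2 * n))] _ _ _ _

theorem homStar_smul (c : ℂ) (x : A.P true (n + k)) :
    A.homStar k n (c • x) = starRingEnd ℂ c • A.homStar k n x := by
  simp only [homStar_eq_ev, A.adj_smul]
  exact ev_smul [(0, C (2 * n))] _ _ _ _

theorem grStar_apply (x : A.Gr k) (n : ℕ) : A.grStar k x n = A.homStar k n (x n) :=
  DFinsupp.mapRange_apply _ _ _ _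

theorem grStar_add (x y : A.Gr k) : A.grStar k (x + y) = A.grStar k x + A.grStar k y := by
  ext n
  simp only [DirectSum.add_apply, grStar_apply, homStar_add]

theorem grStar_smul (c : ℂ) (x : A.Gr k) :
    A.grStar k (c • x) = starRingEnd ℂ c • A.grStar k x := by
  ext n
  simp only [DirectSum.smul_apply, grStar_apply, homStar_smul]

theorem grStar_zero : A.grStar k 0 = 0 := by
  simpa using grStar_smul 0 (0 : A.Gr k)

theorem grStar_hom (x : A.P true (n + k)) :
    A.grStar k (A.hom k n x) = A.hom k n (A.homStar k n x) :=
  DFinsupp.mapRange_single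

open scoped Classical in
theorem grInner_eq_sum (hA : A.IsSubfactor) (x y : A.Gr k) (S : Finset ℕ)
    (hS : DFinsupp.support x ⊆ S) :
    A.grInner k x y = ∑ n ∈ S, (A.delta ^ k)⁻¹ * A.form (x n) (y n) := by
  refine Finset.sum_subset hS fun n _ hn => ?_
  rw [DFinsupp.notMem_support_iff] at hn
  rw [show x n = 0 from hn, form_zero_left hA, mul_zero]

theorem grInner_add_left (hA : A.IsSubfactor) (x y z : A.Gr k) :
    A.grInner k (x + y) z = A.grInner k x z + A.grInner k y z := by
  classical
  let S := DFinsupp.support x ∪ DFinsupp.support y ∪ DFinsupp.support (x + y)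
  rw [grInner_eq_sum hA x z S, grInner_eq_sum hA y z S, grInner_eq_sum hA (x + y) z S,
    ← Finset.sum_add_distrib]
  · simp only [DirectSum.add_apply, form_add_left hA, mul_add]
  · exact Finset.subset_union_right
  · exact Finset.subset_union_right.trans Finset.subset_union_left
  · exact Finset.subset_union_left.trans Finset.subset_union_left

theorem grInner_smul_left (hA : A.IsSubfactor) (c : ℂ) (x y : A.Gr k) :
    A.grInner k (c • x) y = c * A.grInner k x y := by
  classical
  let S := DFinsupp.support x ∪ DFinsupp.support (c • x)
  rw [grInner_eq_sum hA x y S, grInner_eq_sum hA (c • x) y S, Finset.mul_sum]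
  · refine Finset.sum_congr rfl fun n _ => ?_
    rw [DirectSum.smul_apply, form_smul_left hA]
    ring
  · exact Finset.subset_union_right
  · exact Finset.subset_union_left

theorem delta_conj (hA : A.IsSubfactor) : starRingEnd ℂ A.delta = A.delta := by
  rw [delta_eq_form, form_conj hA]

theorem grInner_conj (hA : A.IsSubfactor) (x y : A.Gr k) :
    starRingEnd ℂ (A.grInner k x y) = A.grInner k y x := by
  classical
  let S := DFinsupp.support x ∪ DFinsupp.support y
  rw [grInner_eq_sum hA x y S, grInner_eq_sum hA y x S, map_sum]
  · simp only [map_mul, map_inv₀, map_pow, delta_conj hA, form_conj hA]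
  · exact Finset.subset_union_right
  · exact Finset.subset_union_left

theorem grInner_add_right (hA : A.IsSubfactor) (x y z : A.Gr k) :
    A.grInner k x (y + z) = A.grInner k x y + A.grInner k x z := by
  simp only [← grInner_conj hA _ x, grInner_add_left hA, map_add]

/-- The inner product with a fixed vector. -/
noncomputable def innerLeft (hA : A.IsSubfactor) (y : A.Gr k) : A.Gr k →ₗ[ℂ] ℂ where
  toFun x := A.grInner k x y
  map_add' x x' := grInner_add_left hA x x' y
  map_smul' c x := grInner_smul_left hA c x y

theorem grInner_sum_left (hA : A.IsSubfactor) {ι : Type*} (S : Finset ι) (f : ι → A.Gr k)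
    (y : A.Gr k) : A.grInner k (∑ i ∈ S, f i) y = ∑ i ∈ S, A.grInner k (f i) y :=
  map_sum (innerLeft hA y) f S

theorem grInner_zero_left (hA : A.IsSubfactor) (y : A.Gr k) : A.grInner k 0 y = 0 :=
  map_zero (innerLeft hA y)

theorem grInner_zero_right (hA : A.IsSubfactor) (y : A.Gr k) : A.grInner k y 0 = 0 := by
  rw [← grInner_conj hA, grInner_zero_left hA, map_zero]

theorem grInner_sub_left (hA : A.IsSubfactor) (x y z : A.Gr k) :
    A.grInner k (x - y) z = A.grInner k x z - A.grInner k y z :=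
  map_sub (innerLeft hA z) x y

theorem grInner_hom_left (hA : A.IsSubfactor) (a : A.P true (n + k)) (y : A.Gr k) :
    A.grInner k (A.hom k n a) y = (A.delta ^ k)⁻¹ * A.form a (y n) := by
  classical
  have hs : DFinsupp.support (A.hom k n a) ⊆ {n} :=
    DFinsupp.support_single_subset (β := fun n => A.P true (n + k))
  rw [grInner_eq_sum hA _ _ {n} hs, Finset.sum_singleton, hom_apply_self]

theorem grInner_hom (hA : A.IsSubfactor) (a b : A.P true (n + k)) :
    A.grInner k (A.hom k n a) (A.hom k n b) = (A.delta ^ k)⁻¹ * A.form a b := by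
  rw [grInner_hom_left hA, hom_apply_self]

theorem grInner_hom_ne (hA : A.IsSubfactor) (h : m ≠ n) (a : A.P true (m + k))
    (b : A.P true (n + k)) : A.grInner k (A.hom k m a) (A.hom k n b) = 0 := by
  rw [grInner_hom_left hA, hom_apply_ne h, form_zero_right hA, mul_zero]

theorem grInner_mul_hom (hA : A.IsSubfactor) (a : A.P true (m + k)) (b : A.P true (n + k))
    (c : A.P true (N + k)) :
    A.grInner k (A.grMul k (A.hom k m a) (A.hom k n b)) (A.hom k N c) =
      (A.delta ^ k)⁻¹ * A.form (A.term k m n N a b) c := by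
  rw [grMul_hom_eq_sum_degree (R := m + n + N + 1) (by omega), grInner_sum_left hA,
    Finset.sum_eq_single N, grInner_hom hA]
  · exact fun u _ hu => grInner_hom_ne hA hu _ _
  · exact fun h => absurd (Finset.mem_range.2 (by omega)) h

theorem grInner_mul_left (hA : A.IsSubfactor) (x y z : A.Gr k) :
    A.grInner k (A.grMul k x y) z = A.grInner k y (A.grMul k (A.grStar k x) z) := by
  induction x using gr_induction with
  | h0 => simp [grStar_zero, grInner_zero_left hA, grInner_zero_right hA]
  | add x x' hx hx' =>
    simp only [map_add, LinearMap.add_apply, grStar_add, grInner_add_left hA,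
      grInner_add_right hA, hx, hx']
  | hom m a =>
  induction y using gr_induction with
  | h0 => simp [grInner_zero_left hA]
  | add x x' hx hx' => simp only [map_add, grInner_add_left hA, hx, hx']
  | hom n b =>
  induction z using gr_induction with
  | h0 => simp [grInner_zero_right hA]
  | add x x' hx hx' => simp only [map_add, grInner_add_right hA, hx, hx']
  | hom N c =>
  -- `grInner_mul_hom` needs the product in the first slot, so one side is conjugated; that `δ` is
  -- real removes the conjugation from the factor.
  rw [← grInner_conj hA _ (A.hom k n b), grStar_hom, grInner_mul_hom hA, grInner_mul_hom hA,
    form_term hA, map_mul, form_conj hA, map_inv₀, map_pow, delta_conj hA]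

/-- Only equal degrees contribute: a product reaches degree `0` exactly when all top strings of both
factors are joined. With adjointness this makes the involution isometric. -/
theorem grInner_star_eq_mul_one (hA : A.IsSubfactor) (x y : A.Gr k) :
    A.grInner k x (A.grStar k y) = A.grInner k (A.grMul k x y) (A.grOne k) := by
  induction x using gr_induction with
  | h0 => simp [grInner_zero_left hA]
  | add x x' hx hx' => simp only [map_add, LinearMap.add_apply, grInner_add_left hA, hx, hx']
  | hom m a =>
  induction y using gr_induction with
  | h0 => simp [grStar_zero, grInner_zero_left hA, grInner_zero_right hA]
  | add x x' hx hx' =>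
    simp only [map_add, grStar_add, grInner_add_left hA, grInner_add_right hA, hx, hx']
  | hom n b =>
  rw [grOne, grInner_mul_hom hA, grStar_hom]
  by_cases h : m = n
  · subst h
    rw [grInner_hom hA, form_homStar]
  · rw [grInner_hom_ne hA h, term_of_not_tri (by unfold Tri; omega), form_zero_left hA, mul_zero]

/-- `form_pos` gives `δ > 0` unless the single minimum is zero. In that degenerate case the factor
is `1` for `k = 0`, and for `k ≥ 1` all summands of `Gr k` have strings and vanish. -/
theorem inv_delta_pow_or (hA : A.IsSubfactor) (k : ℕ) :
    (∃ r : ℝ, 0 < r ∧ (A.delta ^ k)⁻¹ = r) ∨ ∀ x : A.Gr k, x = 0 := by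
  by_cases h : A.ev true 1 [(0, C 1)] = 0
  · cases k with
    | zero => exact .inl ⟨1, one_pos, by simp⟩
    | succ k =>
      refine .inr fun x => ?_
      ext n
      exact eq_zero_of_cup_eq_zero (n := n + k) h _
  · obtain ⟨h1, h2⟩ := hA.form_pos _ _ _ h
    rw [← delta_eq_form] at h1 h2
    refine .inl ⟨(A.delta.re ^ k)⁻¹, by positivity, ?_⟩
    have : A.delta = (A.delta.re : ℂ) := Complex.ext rfl (by simpa using h2)
    rw [this]
    simp

theorem form_self_nonneg (hA : A.IsSubfactor) {s : Bool} (x : A.P s n) : 0 ≤ (A.form x x).re := by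
  by_cases h : x = 0
  · simp [h, form_zero_left hA]
  · exact (hA.form_pos _ _ _ h).1.le

theorem grInner_pos (hA : A.IsSubfactor) (x : A.Gr k) (hx : x ≠ 0) :
    0 < (A.grInner k x x).re := by
  classical
  rcases inv_delta_pow_or hA k with ⟨r, hr, h⟩ | h
  swap
  · exact absurd (h x) hx
  rw [grInner_eq_sum hA x x _ subset_rfl, Complex.re_sum]
  simp only [h, Complex.re_ofReal_mul]
  obtain ⟨n, hn⟩ := Finset.nonempty_iff_ne_empty.2 (mt DFinsupp.support_eq_empty.1 hx)
  refine Finset.sum_pos' (fun n _ => mul_nonneg hr.le (form_self_nonneg hA _)) ⟨n, hn, ?_⟩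
  exact mul_pos hr (hA.form_pos _ _ (x n) (DFinsupp.mem_support_iff.1 hn)).1

theorem eq_of_grInner_left (hA : A.IsSubfactor) {x y : A.Gr k}
    (h : ∀ z, A.grInner k x z = A.grInner k y z) : x = y := by
  by_contra hne
  have := grInner_pos hA (x - y) (sub_ne_zero.2 hne)
  rw [grInner_sub_left hA, h, sub_self] at this
  simp at this

theorem eq_of_grInner_right (hA : A.IsSubfactor) {x y : A.Gr k}
    (h : ∀ z, A.grInner k z x = A.grInner k z y) : x = y :=
  eq_of_grInner_left hA fun z => by rw [← grInner_conj hA, h, grInner_conj hA]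

theorem grInner_star_mul_left (hA : A.IsSubfactor) (x y z : A.Gr k) :
    A.grInner k (A.grMul k (A.grStar k x) y) z = A.grInner k y (A.grMul k x z) := by
  rw [← grInner_conj hA, ← grInner_conj hA (A.grMul k x z), grInner_mul_left hA]

/-- No picture is needed: multiplications by `x` and by its star are adjoint, an element is its
product with the unit, and the inner product is nondegenerate. `grStar_mul` uses the same device. -/
theorem grStar_grStar (hA : A.IsSubfactor) (x : A.Gr k) : A.grStar k (A.grStar k x) = x := by
  refine eq_of_grInner_right hA fun z => ?_
  rw [← grMul_one (A.grStar k (A.grStar k x)), ← grInner_mul_left hA, grInner_star_mul_left hA,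
    grMul_one]

theorem grStar_mul (hA : A.IsSubfactor) (x y : A.Gr k) :
    A.grStar k (A.grMul k x y) = A.grMul k (A.grStar k y) (A.grStar k x) := by
  refine eq_of_grInner_right hA fun z => ?_
  rw [← grMul_one (A.grStar k (A.grMul k x y)), ← grInner_mul_left hA, grMul_assoc,
    grInner_mul_left hA, grInner_mul_left hA, grMul_one]

theorem grInner_star_star (hA : A.IsSubfactor) (x y : A.Gr k) :
    A.grInner k (A.grStar k y) (A.grStar k x) = A.grInner k x y := by
  rw [grInner_star_eq_mul_one hA, grInner_mul_left hA, grStar_grStar hA, grMul_one]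

end PlanarStarAlgebra

/-! ### Boundedness of left multiplication -/

/-- A bound for linear functionals that satisfy a Cauchy-Schwarz inequality with respect to a
quadratic map; it does not depend on the functional. -/
theorem exists_bound_of_sq_le {E : Type*} [AddCommGroup E] [Module ℂ E] [FiniteDimensional ℂ E]
    (s : E → E) : ∃ C : E → ℝ, ∀ (φ : E →ₗ[ℂ] ℂ) (R : ℝ), 0 ≤ R →
      (∀ x, ‖φ x‖ ^ 2 ≤ R * ‖φ (s x)‖) → ∀ x, ‖φ x‖ ≤ C x * R := by
  let b := Module.finBasis ℂ E
  let N : E → ℝ := fun x => ∑ i, ‖b.repr x i‖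
  have hN : ∀ x, 0 ≤ N x := fun x => Finset.sum_nonneg fun i _ => norm_nonneg _
  let M : ℝ := ∑ i, N (s (b i))
  refine ⟨fun x => N x * M, fun φ R hR h => ?_⟩
  have hφ : ∀ S : ℝ, (∀ i, ‖φ (b i)‖ ≤ S) → ∀ x, ‖φ x‖ ≤ N x * S := by
    intro S hS x
    conv_lhs => rw [← b.sum_repr x, map_sum]
    refine (norm_sum_le _ _).trans ?_
    rw [Finset.sum_mul]
    refine Finset.sum_le_sum fun i _ => ?_
    rw [map_smul, norm_smul]
    exact mul_le_mul_of_nonneg_left (hS i) (norm_nonneg _)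
  suffices hS : ∀ i, ‖φ (b i)‖ ≤ M * R by
    intro x
    rw [mul_assoc]
    exact hφ _ hS x
  intro i
  -- At the basis vector where `φ` is largest, expanding `s (b j)` in the basis gives `‖φ (s (b j))‖
  -- ≤ M * ‖φ (b j)‖`. One factor `‖φ (b j)‖` then cancels from the quadratic inequality.
  obtain ⟨j, -, hj⟩ := Finset.exists_max_image Finset.univ (fun i => ‖φ (b i)‖)
    ⟨i, Finset.mem_univ i⟩
  refine (hj i (Finset.mem_univ i)).trans ?_
  have h1 := hφ _ (fun i => hj i (Finset.mem_univ i)) (s (b j))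
  have h2 := h (b j)
  have h3 : N (s (b j)) ≤ M :=
    Finset.single_le_sum (f := fun i => N (s (b i))) (fun i _ => hN _) (Finset.mem_univ j)
  have h4 : ‖φ (b j)‖ ^ 2 ≤ M * R * ‖φ (b j)‖ := by
    refine h2.trans ?_
    calc R * ‖φ (s (b j))‖ ≤ R * (M * ‖φ (b j)‖) := by gcongr; exact h1.trans (by gcongr)
      _ = M * R * ‖φ (b j)‖ := by ring
  have hM : 0 ≤ M := Finset.sum_nonneg fun i _ => hN _
  rcases (norm_nonneg (φ (b j))).eq_or_lt with h0 | h0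
  · rw [← h0]; positivity
  · rw [pow_two] at h4
    exact le_of_mul_le_mul_right h4 h0

namespace PlanarStarAlgebra

open Blk Diag PlanarAlgebra

variable {A : PlanarStarAlgebra.{u}} {k m n N : ℕ}

/-- The inner product space structure of `Gr k`. -/
@[reducible]
noncomputable def grCore (hA : A.IsSubfactor) (k : ℕ) : InnerProductSpace.Core ℂ (A.Gr k) where
  -- The arguments are exchanged because `inner` is conjugate-linear in its first variable.
  inner x y := A.grInner k y x
  conj_inner_symm x y := grInner_conj hA x y
  re_inner_nonneg x := by
    by_cases h : x = 0
    · simp [h, grInner_zero_left hA]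
    · exact (grInner_pos hA x h).le
  add_left x y z := grInner_add_right hA z x y
  smul_left x y c := by
    rw [← grInner_conj hA, grInner_smul_left hA, map_mul, grInner_conj hA]
  definite x h := by
    by_contra hx
    have := grInner_pos hA x hx
    rw [h] at this
    simp at this

theorem formNorm_sq (hA : A.IsSubfactor) (x : A.Gr k) :
    formNorm (A.grInner k) x ^ 2 = (A.grInner k x x).re :=
  Real.sq_sqrt ((grCore hA k).re_inner_nonneg x)

theorem formNorm_nonneg (x : A.Gr k) : 0 ≤ formNorm (A.grInner k) x := Real.sqrt_nonneg _

theorem formNorm_zero (hA : A.IsSubfactor) : formNorm (A.grInner k) 0 = 0 := by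
  simp [formNorm, grInner_zero_left hA]

theorem formNorm_add_le (hA : A.IsSubfactor) (x y : A.Gr k) :
    formNorm (A.grInner k) (x + y) ≤ formNorm (A.grInner k) x + formNorm (A.grInner k) y :=
  let := (grCore hA k).toNormedAddCommGroup
  norm_add_le x y

theorem norm_grInner_le (hA : A.IsSubfactor) (x y : A.Gr k) :
    ‖A.grInner k x y‖ ≤ formNorm (A.grInner k) x * formNorm (A.grInner k) y := by
  let := (grCore hA k).toNormedAddCommGroup
  let := InnerProductSpace.ofCore (grCore hA k).toCore
  rw [mul_comm]
  exact norm_inner_le_norm (𝕜 := ℂ) y x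

/-- After `a` is moved across and the product reassociated, the `2 * m - i` top strings of `a` not
joined to `x` are joined to its star. The norm is thereby expressed through an element of `P_{i,k}`,
a space independent of `n`. -/
theorem grInner_hom_term (hA : A.IsSubfactor) {i : ℕ} (hi : N + i = m + n) (hm : i ≤ 2 * m)
    (hn : i ≤ 2 * n) (a : A.P true (m + k)) (x : A.P true (n + k)) :
    A.grInner k (A.hom k N (A.term k m n N a x)) (A.hom k N (A.term k m n N a x)) =
      A.grInner k (A.hom k n x)
        (A.hom k n (A.term k i n n (A.term k m m i (A.homStar k m a) a) x)) := by
  rw [grInner_hom hA, grInner_hom hA, form_term hA]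
  rw [term_assoc (p := 2 * m - i) (q := i) (r := 0) (v := N)] <;> omega

theorem formNorm_hom_term_sq_le (hA : A.IsSubfactor) {i : ℕ} (hi : N + i = m + n)
    (hm : i ≤ 2 * m) (hn : i ≤ 2 * n) (a : A.P true (m + k)) (x : A.P true (n + k)) :
    formNorm (A.grInner k) (A.hom k N (A.term k m n N a x)) ^ 2 ≤
      ‖A.grInner k (A.hom k n (A.term k i n n (A.term k m m i (A.homStar k m a) a) x))
        (A.hom k n x)‖ := by
  rw [formNorm_sq hA, grInner_hom_term hA hi hm hn, ← grInner_conj hA, Complex.conj_re]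
  exact Complex.re_le_norm _

/-- The terms with `i` joined top strings of left multiplication by `a` are uniformly bounded. -/
theorem exists_formNorm_term_le (hA : A.IsSubfactor) {i : ℕ} (hm : i ≤ 2 * m)
    (a : A.P true (m + k)) : ∃ C : ℝ, 0 ≤ C ∧ ∀ (n N : ℕ) (x : A.P true (n + k)),
      N + i = m + n → i ≤ 2 * n →
      formNorm (A.grInner k) (A.hom k N (A.term k m n N a x)) ^ 2 ≤
        C * formNorm (A.grInner k) (A.hom k n x) ^ 2 := by
  have := hA.finiteDimensional true (i + k)
  obtain ⟨C, hC⟩ := exists_bound_of_sq_le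
    (fun y : A.P true (i + k) => A.term k i i i (A.homStar k i y) y)
  refine ⟨|C (A.term k m m i (A.homStar k m a) a)|, abs_nonneg _, fun n N x hN hn => ?_⟩
  refine (formNorm_hom_term_sq_le hA hN hm hn a x).trans ?_
  -- `φ y = ⟨y · x, x⟩`: the domain and the map `y ↦ y* y` depend only on `i` and `k`, which is why
  -- `C` serves every `n` and `x`.
  let φ : A.P true (i + k) →ₗ[ℂ] ℂ :=
    innerLeft hA (A.hom k n x) ∘ₗ A.hom k n ∘ₗ (A.term k i n n).flip x
  refine (hC φ (formNorm (A.grInner k) (A.hom k n x) ^ 2) (sq_nonneg _) (fun y => ?_) _).trans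
    (mul_le_mul_of_nonneg_right (le_abs_self _) (sq_nonneg _))
  have h1 : ‖φ y‖ ≤ _ := norm_grInner_le hA (A.hom k n (A.term k i n n y x)) (A.hom k n x)
  -- The same estimate with `y`, of degree `i`, in place of `a`: `‖y · x‖² ≤ |φ (y* y)|`. With
  -- Cauchy-Schwarz this is the hypothesis of `exists_bound_of_sq_le`.
  have h2 := formNorm_hom_term_sq_le hA (add_comm n i) (by omega) hn y x
  calc ‖φ y‖ ^ 2 ≤ _ := pow_le_pow_left₀ (norm_nonneg _) h1 2
    _ = formNorm (A.grInner k) (A.hom k n x) ^ 2 *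
        formNorm (A.grInner k) (A.hom k n (A.term k i n n y x)) ^ 2 := by ring
    _ ≤ _ := mul_le_mul_of_nonneg_left h2 (sq_nonneg _)

theorem formNorm_sum_sq (hA : A.IsSubfactor) (S : Finset ℕ) (f : ℕ → A.Gr k)
    (h : ∀ i ∈ S, ∀ j ∈ S, i ≠ j → A.grInner k (f i) (f j) = 0) :
    formNorm (A.grInner k) (∑ i ∈ S, f i) ^ 2 = ∑ i ∈ S, formNorm (A.grInner k) (f i) ^ 2 := by
  simp only [formNorm_sq hA]
  rw [← Complex.re_sum, grInner_sum_left hA]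
  congr 1
  refine Finset.sum_congr rfl fun i hi => ?_
  rw [← grInner_conj hA, grInner_sum_left hA, map_sum, Finset.sum_eq_single i]
  · rw [grInner_conj hA]
  · intro j hj hij
    rw [h j hj i hi hij, map_zero]
  · exact fun h' => absurd hi h'

-- For fixed `i` the degree `m + n - i` is injective in `n` where terms are nonzero, so images of
-- different degrees are orthogonal. Pythagoras then transfers the uniform bound without loss.
open scoped Classical in
theorem exists_formNorm_sum_term_le (hA : A.IsSubfactor) {i : ℕ} (hm : i ≤ 2 * m)
    (a : A.P true (m + k)) : ∃ C : ℝ, ∀ x : A.Gr k,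
      formNorm (A.grInner k) (∑ n ∈ DFinsupp.support x,
        A.hom k (m + n - i) (A.term k m n (m + n - i) a (x n))) ≤
        C * formNorm (A.grInner k) x := by
  obtain ⟨C, hC0, hC⟩ := exists_formNorm_term_le hA hm a
  -- This also disposes of the degrees where the subtraction `m + n - i` is truncated and
  -- injectivity could fail.
  have hz : ∀ n (y : A.P true (n + k)), ¬ (i ≤ m + n ∧ i ≤ 2 * n) →
      A.term k m n (m + n - i) a y = 0 := by
    intro n y h
    refine term_of_not_tri ?_ _ _
    unfold Tri
    omega
  refine ⟨Real.sqrt C, fun x => ?_⟩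
  refine abs_le_of_sq_le_sq' ?_ (mul_nonneg (Real.sqrt_nonneg _) (formNorm_nonneg _)) |>.2
  rw [mul_pow, Real.sq_sqrt hC0]
  conv_rhs => rw [← sum_support_hom x]
  rw [formNorm_sum_sq hA, formNorm_sum_sq hA, Finset.mul_sum]
  · refine Finset.sum_le_sum fun n _ => ?_
    by_cases h : i ≤ m + n ∧ i ≤ 2 * n
    · exact hC n _ _ (by omega) h.2
    · rw [hz n _ h, map_zero, formNorm_zero hA, zero_pow two_ne_zero]
      exact mul_nonneg hC0 (sq_nonneg _)
  · exact fun n _ n' _ h => grInner_hom_ne hA h _ _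
  · intro n _ n' _ hne
    by_cases h : i ≤ m + n ∧ i ≤ 2 * n
    swap
    · rw [hz n _ h, map_zero, grInner_zero_left hA]
    by_cases h' : i ≤ m + n' ∧ i ≤ 2 * n'
    swap
    · rw [hz n' _ h', map_zero, grInner_zero_right hA]
    exact grInner_hom_ne hA (by omega) _ _

theorem exists_formNorm_sum_le (hA : A.IsSubfactor) {ι : Type*} (S : Finset ι)
    (f : ι → A.Gr k → A.Gr k) (h : ∀ i ∈ S, ∃ C : ℝ, ∀ x,
      formNorm (A.grInner k) (f i x) ≤ C * formNorm (A.grInner k) x) :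
    ∃ C : ℝ, ∀ x, formNorm (A.grInner k) (∑ i ∈ S, f i x) ≤ C * formNorm (A.grInner k) x := by
  classical
  induction S using Finset.induction_on with
  | empty => exact ⟨0, fun x => by simp [formNorm_zero hA]⟩
  | insert i S hi ih =>
    obtain ⟨C, hC⟩ := h i (Finset.mem_insert_self i S)
    obtain ⟨D, hD⟩ := ih fun j hj => h j (Finset.mem_insert_of_mem hj)
    refine ⟨C + D, fun x => ?_⟩
    rw [Finset.sum_insert hi, add_mul]
    exact (formNorm_add_le hA _ _).trans (add_le_add (hC x) (hD x))

/-- Left multiplications of `Gr k` are bounded. -/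
theorem exists_formNorm_mul_le (hA : A.IsSubfactor) (a : A.Gr k) : ∃ C : ℝ, ∀ x : A.Gr k,
    formNorm (A.grInner k) (A.grMul k a x) ≤ C * formNorm (A.grInner k) x := by
  classical
  induction a using gr_induction with
  | h0 => exact ⟨0, fun x => by simp [formNorm_zero hA]⟩
  | add a b ha hb =>
    obtain ⟨C, hC⟩ := ha
    obtain ⟨D, hD⟩ := hb
    refine ⟨C + D, fun x => ?_⟩
    rw [map_add, LinearMap.add_apply, add_mul]
    exact (formNorm_add_le hA _ _).trans (add_le_add (hC x) (hD x))
  | hom m a =>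
    obtain ⟨C, hC⟩ := exists_formNorm_sum_le hA (Finset.range (2 * m + 1))
      (fun i x => ∑ n ∈ DFinsupp.support x,
        A.hom k (m + n - i) (A.term k m n (m + n - i) a (x n)))
      fun i hi => exists_formNorm_sum_term_le hA
        (Nat.lt_succ_iff.1 (Finset.mem_range.1 hi)) a
    refine ⟨C, fun x => ?_⟩
    convert hC x using 2
    -- The bound was obtained with `i` outside and `n` inside; the product is the same double sum in
    -- the other order.
    rw [Finset.sum_comm]
    conv_lhs => rw [← sum_support_hom x, map_sum]
    exact Finset.sum_congr rfl fun n _ => grMul_hom_eq_sum_range a (x n)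

/-! ### The Hilbert algebra axioms -/

theorem isHilbertAlgebra_gr (hA : A.IsSubfactor) (k : ℕ) :
    IsHilbertAlgebra (fun a b : A.Gr k => A.grMul k a b) (A.grStar k) (A.grInner k) where
  add_mul x y z := by simp only [map_add, LinearMap.add_apply]
  mul_add x y z := map_add _ _ _
  smul_mul c x y := by simp only [map_smul, LinearMap.smul_apply]
  mul_smul c x y := map_smul _ _ _
  mul_assoc := grMul_assoc
  inv_add := grStar_add
  inv_smul := grStar_smul
  inv_inv := grStar_grStar hA
  inv_mul := grStar_mul hA
  ip_add_left := grInner_add_left hA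
  ip_smul_left := grInner_smul_left hA
  ip_conj := grInner_conj hA
  ip_pos := grInner_pos hA
  ip_inv := grInner_star_star hA
  ip_mul_left := grInner_mul_left hA
  bounded := exists_formNorm_mul_le hA
  dense x ε hε := by
    -- Thanks to the unit every element is itself a product, so the approximation is exact.
    refine ⟨x, Submodule.subset_span ⟨A.grOne k, x, (grOne_mul x).symm⟩, ?_⟩
    rwa [sub_self, formNorm_zero hA]

end PlanarStarAlgebra

theorem mainTheorem5 (A : PlanarStarAlgebra.{u}) (hA : A.IsSubfactor) (k : ℕ) :
    (∀ a : A.Gr k, ∃ C : ℝ, ∀ ξ : A.Gr k,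
      formNorm (A.grInner k) (A.grMul k a ξ) ≤ C * formNorm (A.grInner k) ξ) ∧
    IsHilbertAlgebra (fun a b : A.Gr k => A.grMul k a b) (A.grStar k) (A.grInner k) :=
  ⟨PlanarStarAlgebra.exists_formNorm_mul_le hA, PlanarStarAlgebra.isHilbertAlgebra_gr hA k⟩
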